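/- **Setting.** Let $(\mathbf x_i,y_i)_{i=1}^m\subseteq\mathbb R^d\times\{\pm1\}$, $m\ge 1$, be a dataset and $f(\mathbf x;\theta)$ a real-valued model with parameters $\theta=(W_1,\dots,W_K,\mathbf u)\in\mathbb R^p$, where the $W_k$ are real matrices and $\mathbf u\in\mathbb R^n$. The loss is $\mathcal L(\theta)=\sum_{i=1}^m\ell(y_if(\mathbf x_i;\theta))$ with $\ell=e^{-\varphi}$, where $\varphi\in C^2(\mathbb R)$ and, for some constants $B_1,B_2$, $0<\varphi'\le B_1$ and $0\le\varphi''\le B_2$ everywhere. $\partial$ denotes the Clarke subdifferential $\partial F(\theta)=\operatorname{conv}\{\lim_k\nabla F(\theta_k):\theta_k\to\theta,\ F\text{ differentiable at }\theta_k\}$. Put $$\|\theta\|=\max\Big\{\max_{k}\|W_k\|_{\rm sp},\ \|\mathbf u\|_\infty\Big\},\qquad \gamma(\theta)=\min_i y_if\big(\mathbf x_i;\theta/\|\theta\|\big),$$ with $\|\cdot\|_{\rm sp}$ the spectral norm. **Algorithms.** Let $c>0$, let $\eta(t)>0$ be a schedule, let $\theta_t$, $t\ge0$, be an arc (absolutely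 continuous on compact intervals), let $\mathbf g_t\in\partial\mathcal L(\theta_t)$ be a measurable choice of subgradients, and let $\mathbf m_t=\int_0^tce^{-c(t-s)}\mathbf g_s\,ds=(M_1(t),\dots,M_K(t),\mathbf m^{u}_t)$. For a norm $N$, $\theta_t$ is a trajectory of *normalized momentum steepest descent* with respect to $N$ if for a.e. $t\ge 0$ $$\frac{d\theta_t}{dt}\in\eta(t)\cdot\arg\min_{N(\mathbf v)=1}\langle\mathbf v,\mathbf m_t\rangle .$$ $\theta_t$ is a trajectory of *Muon-Signum* if for a.e. $t\ge 0$: for every $k$, $\frac{dW_k}{dt}=-\eta(t)U_kV_k^{\top}$ for some reduced SVD $M_k(t)=U_k\Sigma_kV_k^\top$ ($U_k,V_k$ with orthonormal columns, $\Sigma_k$ diagonal with strictly positive diagonal), and $\frac{d\mathbf u}{dt}\in\eta(t)\cdot\arg\min_{\|\mathbf v\|_\infty=1}\langle\mathbf v,\mathbf m_t^{u}\rangle$. **Statement.** Let $\theta_t$ be a trajectory of Muon-Signum. 1. $\|\cdot\|$ is a norm and $\theta_t$ (with the same $c,\eta,\mathbf g_t$) is a trajectory of normalized momentum steepest descent with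 respect to $\|\cdot\|$. 2. Assume moreover, for some real $L\ge1$: * $f(\mathbf x;\alpha\theta)=\alpha^Lf(\mathbf x;\theta)$ for all $\mathbf x,\theta$ and $\alpha>0$; * $\int_0^\infty\eta=\infty$ and $\eta(t)=o(t^{1/L-1})$ as $t\to\infty$; * there are $N_{\min}>0$, $t_0\ge0$ with $\|\theta_t\|\ge N_{\min}$ for all $t\ge t_0$; * $\theta_t/\|\theta_t\|\to\bar\theta$ as $t\to\infty$, with $\gamma(\bar\theta)>0$; * either (a) $f(\mathbf x;\cdot)\in C^1$ for all $\mathbf x$; or (b) for all $\mathbf x$, $f(\mathbf x;\cdot)$ is locally Lipschitz and Whitney $C^1$-stratifiable (its graph has a finite partition into nonempty embedded $C^1$ submanifolds satisfying the frontier condition and Whitney's condition (a)), and there are $\mathbf h_i(t)\in\partial f(\mathbf x_i;\theta_t)$ with $\mathbf g_t=-\sum_i\ell(z_i^t)\varphi'(z_i^t)y_i\mathbf h_i(t)$, $z_i^t=y_if(\mathbf x_i;\theta_t)$, for all $t\ge 0$, such that every $\mathbf h_i(t)/\|\theta_t\|^{L-1}$ converges as $t\to\infty$. Then $\bar\theta$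 is the direction of a KKT point of $$\min_\theta\tfrac12\|\theta\|^2\quad\text{s.t. } y_if(\mathbf x_i;\theta)\ge1\ \ \forall i :$$ there is $a>0$ such that $\theta^\star=a\bar\theta$ is feasible and there exist $\mathbf k\in\partial\tfrac12\|\theta^\star\|^2$, $\lambda_i\ge0$ and $\mathbf h_i\in\partial f(\mathbf x_i;\theta^\star)$ with $\sum_i\lambda_iy_i\mathbf h_i=\mathbf k$ and $\sum_i\lambda_i(y_if(\mathbf x_i;\theta^\star)-1)=0$. -/

import Mathlib

open Filter Topology MeasureTheory Set

noncomputable section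

namespace MuonSignum

/-! ### Norms, Clarke subdifferential, arcs, momentum, normalized momentum steepest descent -/

section General

variable {V : Type*} [NormedAddCommGroup V] [InnerProductSpace ℝ V] [CompleteSpace V]

/-- `N` is a norm on the real vector space `V` (in general different from the Euclidean norm that
`V` carries as an inner product space). -/
structure IsNorm (N : V → ℝ) : Prop where
  nonneg : ∀ v, 0 ≤ N v
  eq_zero_of : ∀ v, N v = 0 → v = 0
  smul : ∀ (a : ℝ) (v : V), N (a • v) = |a| * N v
  triangle : ∀ v w, N (v + w) ≤ N v + N w

/-- The Clarke subdifferential: convex hull of all limits of gradients `∇F(w_k)` along sequences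
`w_k → w` of points of differentiability. -/
def clarkeSubdiff (F : V → ℝ) (w : V) : Set V :=
  convexHull ℝ {l | ∃ s : ℕ → V, Tendsto s atTop (𝓝 w) ∧ (∀ k, DifferentiableAt ℝ F (s k)) ∧
    Tendsto (fun k => gradient F (s k)) atTop (𝓝 l)}

/-- An arc `[0, ∞) → V`: a primitive of a function that is integrable on every `[0, t]`. -/
def IsArc (θ : ℝ → V) : Prop :=
  ∃ v : ℝ → V, (∀ t, 0 ≤ t → IntervalIntegrable v volume 0 t) ∧
    ∀ t, 0 ≤ t → θ t = θ 0 + ∫ s in (0 : ℝ)..t, v s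

/-- The momentum estimate `m_t = ∫₀ᵗ c e^{-c(t-s)} g_s ds`. -/
def momentum (c : ℝ) (g : ℝ → V) (t : ℝ) : V :=
  ∫ s in (0 : ℝ)..t, (c * Real.exp (-c * (t - s))) • g s

/-- `argmin_{N(v) = 1} ⟨v, m⟩`. -/
def steepestDirections (N : V → ℝ) (m : V) : Set V :=
  {v | N v = 1 ∧ ∀ w, N w = 1 → inner ℝ v m ≤ inner ℝ w m}

/-- What every momentum method shares: a loss `ℒ`, a momentum parameter `c > 0`, a schedule
`η > 0`, an arc `θ`, and a (measurable) choice of subgradients `g_t ∈ ∂ℒ(θ_t)` along it. -/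
structure IsMomentumSetup (ℒ : V → ℝ) (c : ℝ) (η : ℝ → ℝ) (θ g : ℝ → V) : Prop where
  c_pos : 0 < c
  η_pos : ∀ t, 0 < t → 0 < η t
  arc : IsArc θ
  measurable_g : AEStronglyMeasurable g (volume.restrict (Ici 0))
  g_mem : ∀ t, 0 ≤ t → g t ∈ clarkeSubdiff ℒ (θ t)

/-- Normalized momentum steepest descent with respect to the norm `N`:
`dθ_t/dt ∈ η(t) · argmin_{N(v) = 1} ⟨v, m_t⟩` for almost every `t ≥ 0`. -/
structure IsNormalizedMSD (N : V → ℝ) (ℒ : V → ℝ) (c : ℝ) (η : ℝ → ℝ) (θ g : ℝ → V) : Prop where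
  isNorm : IsNorm N
  setup : IsMomentumSetup ℒ c η θ g
  update : ∀ᵐ t ∂(volume.restrict (Ici (0 : ℝ))),
    ∃ v ∈ steepestDirections N (momentum c g t), HasDerivAt θ (η t • v) t

end General

/-! ### Whitney `C¹`-stratifiable functions -/

section Stratification

variable {F : Type*} [NormedAddCommGroup F] [InnerProductSpace ℝ F]

/-- `M` is an embedded `C¹` submanifold of `F`, of some constant codimension `q`: locally the zero
set of a `C¹` map to `ℝ^q` whose derivative is onto. -/
def IsC1Submanifold (M : Set F) : Prop :=
  ∃ q : ℕ, ∀ z ∈ M, ∃ U : Set F, IsOpen U ∧ z ∈ U ∧ ∃ G : F → EuclideanSpace ℝ (Fin q),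
    ContDiffOn ℝ 1 G U ∧ Function.Surjective (fderiv ℝ G z) ∧ M ∩ U = {w ∈ U | G w = 0}

/-- The normal space at `z`: the vectors orthogonal to the tangent cone of `M` at `z`
(which is the tangent space if `M` is a `C¹` submanifold). -/
def normalSpace (M : Set F) (z : F) : Set F :=
  {v | ∀ w ∈ tangentConeAt ℝ M z, inner ℝ v w = 0}

/-- `𝒮` is a Whitney `C¹`-stratification of `Q`: a finite partition of `Q` into nonempty `C¹`
submanifolds with the frontier condition and Whitney's condition (a). -/
structure IsWhitneyC1Stratification (𝒮 : Set (Set F)) (Q : Set F) : Prop where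
  finite : 𝒮.Finite
  nonempty : ∀ M ∈ 𝒮, M.Nonempty
  submanifold : ∀ M ∈ 𝒮, IsC1Submanifold M
  disjoint : 𝒮.PairwiseDisjoint id
  cover : ⋃₀ 𝒮 = Q
  frontier_condition : ∀ M₁ ∈ 𝒮, ∀ M₂ ∈ 𝒮, (M₁ ∩ closure M₂).Nonempty → M₁ ⊆ closure M₂
  whitney_a : ∀ M₁ ∈ 𝒮, ∀ M₂ ∈ 𝒮, ∀ (z : ℕ → F) (v : ℕ → F) (z₀ v₀ : F),
    (∀ k, z k ∈ M₂) → z₀ ∈ M₁ → Tendsto z atTop (𝓝 z₀) →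
    (∀ k, v k ∈ normalSpace M₂ (z k)) → Tendsto v atTop (𝓝 v₀) → v₀ ∈ normalSpace M₁ z₀

/-- A real function is Whitney `C¹`-stratifiable if its graph (in the Euclidean product with `ℝ`)
has a Whitney `C¹`-stratification. -/
def IsWhitneyC1Stratifiable (f : F → ℝ) : Prop :=
  ∃ 𝒮 : Set (Set (WithLp 2 (F × ℝ))),
    IsWhitneyC1Stratification 𝒮 (range fun w : F => WithLp.toLp 2 (w, f w))

end Stratification

/-! ### Loss, margin, max-margin problem and the standing assumptions -/

section Learning

/-- Conditions on `φ` in the per-sample loss `ℓ(z) = exp(-φ(z))`. -/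
def IsLossExponent (φ : ℝ → ℝ) : Prop :=
  ContDiff ℝ 2 φ ∧
    (∃ B₁ : ℝ, ∀ z, 0 < deriv φ z ∧ deriv φ z ≤ B₁) ∧
    (∃ B₂ : ℝ, ∀ z, 0 ≤ deriv (deriv φ) z ∧ deriv (deriv φ) z ≤ B₂)

variable {V : Type*} [NormedAddCommGroup V] [InnerProductSpace ℝ V] [CompleteSpace V]
variable {X : Type*} {m : ℕ}

/-- `ℒ(θ) = ∑ᵢ exp(-φ(yᵢ f(xᵢ; θ)))`. -/
def loss (φ : ℝ → ℝ) (f : X → V → ℝ) (x : Fin m → X) (y : Fin m → ℝ) (θ : V) : ℝ :=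
  ∑ i, Real.exp (-φ (y i * f (x i) θ))

/-- The hard margin `γ(θ) = minᵢ yᵢ f(xᵢ; θ / N(θ))` with respect to the norm `N`. -/
def margin (N : V → ℝ) (f : X → V → ℝ) (x : Fin m → X) (y : Fin m → ℝ) (θ : V) : ℝ :=
  ⨅ i, y i * f (x i) ((N θ)⁻¹ • θ)

/-- `θ` satisfies the KKT conditions of `min ½ N(θ)²` subject to `yᵢ f(xᵢ; θ) ≥ 1` for all `i`. -/
def IsKKTPoint (N : V → ℝ) (f : X → V → ℝ) (x : Fin m → X) (y : Fin m → ℝ) (θ : V) : Prop :=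
  (∀ i, 1 ≤ y i * f (x i) θ) ∧
    ∃ k ∈ clarkeSubdiff (fun w => (1 / 2 : ℝ) * N w ^ 2) θ, ∃ (lam : Fin m → ℝ) (h : Fin m → V),
      (∀ i, 0 ≤ lam i) ∧ (∀ i, h i ∈ clarkeSubdiff (f (x i)) θ) ∧
      (∑ i, (lam i * y i) • h i) - k = 0 ∧
      ∑ i, lam i * (y i * f (x i) θ - 1) = 0

/-- `f(x; ·)` is positively homogeneous of degree `L` for every `x`. -/
def IsHomogeneous (f : X → V → ℝ) (L : ℝ) : Prop :=
  ∀ (x : X) (θ : V) (a : ℝ), 0 < a → f x (a • θ) = a ^ L * f x θ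

/-- `∫₀^∞ η = ∞` and `η(t) = o(t^{1/L - 1})`. -/
def ScheduleCondition (η : ℝ → ℝ) (L : ℝ) : Prop :=
  Tendsto (fun t => ∫ s in (0 : ℝ)..t, η s) atTop atTop ∧
    η =o[atTop] fun t : ℝ => t ^ (1 / L - 1)

/-- The trajectory is eventually bounded away from the origin. -/
def IsNontrivial (N : V → ℝ) (θ : ℝ → V) : Prop :=
  ∃ Nmin : ℝ, 0 < Nmin ∧ ∃ t₀ : ℝ, 0 ≤ t₀ ∧ ∀ t, t₀ ≤ t → Nmin ≤ N (θ t)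

/-- `θ_t / N(θ_t)` converges to `θbar`, and `θbar` has positive margin. -/
def ConvergesInDirection (N : V → ℝ) (f : X → V → ℝ) (x : Fin m → X) (y : Fin m → ℝ)
    (θ : ℝ → V) (θbar : V) : Prop :=
  Tendsto (fun t => (N (θ t))⁻¹ • θ t) atTop (𝓝 θbar) ∧ 0 < margin N f x y θbar

/-- For subgradients `h_i(t) ∈ ∂f(xᵢ; θ_t)` that compose the chosen loss subgradient,
`g_t = -∑ᵢ ℓ(zᵢ) φ'(zᵢ) yᵢ h_i(t)` with `zᵢ = yᵢ f(xᵢ; θ_t)`, each `h_i(t) / N(θ_t)^{L-1}`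
converges as `t → ∞`. -/
def SubgradientsConverge (N : V → ℝ) (φ : ℝ → ℝ) (f : X → V → ℝ) (x : Fin m → X)
    (y : Fin m → ℝ) (L : ℝ) (θ g : ℝ → V) : Prop :=
  ∃ h : Fin m → ℝ → V,
    (∀ i t, 0 ≤ t → h i t ∈ clarkeSubdiff (f (x i)) (θ t)) ∧
    (∀ t, 0 ≤ t → g t = -∑ i, (Real.exp (-φ (y i * f (x i) (θ t))) *
      deriv φ (y i * f (x i) (θ t)) * y i) • h i t) ∧
    ∀ i, ∃ l : V, Tendsto (fun t => (N (θ t) ^ (L - 1))⁻¹ • h i t) atTop (𝓝 l)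

end Learning

/-! ### Collections of matrices with additional parameters; Muon and Signum -/

section Blocks

variable {K : ℕ}

/-- The parameter space of `(W_1, …, W_K, u)` with `W_k` of size `rows k × cols k` and `u ∈ ℝ^n`,
as the Euclidean space with one coordinate for each matrix entry and for each entry of `u`. -/
abbrev Params (rows cols : Fin K → ℕ) (n : ℕ) : Type :=
  EuclideanSpace ℝ ((Σ k : Fin K, Fin (rows k) × Fin (cols k)) ⊕ Fin n)

variable {rows cols : Fin K → ℕ} {n : ℕ}

/-- The matrix `W_k` of `θ = (W_1, …, W_K, u)`. -/
def matPart (θ : Params rows cols n) (k : Fin K) : Matrix (Fin (rows k)) (Fin (cols k)) ℝ :=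
  Matrix.of fun i j => θ (Sum.inl ⟨k, (i, j)⟩)

/-- The vector `u` of `θ = (W_1, …, W_K, u)`. -/
def vecPart (θ : Params rows cols n) : EuclideanSpace ℝ (Fin n) :=
  WithLp.toLp 2 fun j => θ (Sum.inr j)

/-- The spectral norm of a matrix: its operator norm for the Euclidean norms. -/
def matSpectralNorm {p q : ℕ} (W : Matrix (Fin p) (Fin q) ℝ) : ℝ :=
  ‖LinearMap.toContinuousLinearMap (Matrix.toEuclideanLin W)‖

/-- The norm `‖u‖_∞ = max_j |u_j|`. -/
def linftyNorm (u : EuclideanSpace ℝ (Fin n)) : ℝ := ⨆ j, |u j|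

/-- The norm `max {max_k ‖W_k‖_sp, ‖u‖_∞}`. -/
def hybridNorm (θ : Params rows cols n) : ℝ :=
  max (⨆ k, matSpectralNorm (matPart θ k)) (linftyNorm (vecPart θ))

/-- The possible Muon directions `-U Vᵀ`, for reduced singular value decompositions
`M = U Σ Vᵀ`: `U`, `V` have orthonormal columns, `Σ` is a square diagonal matrix with strictly
positive diagonal. -/
def muonDirections {p q : ℕ} (M : Matrix (Fin p) (Fin q) ℝ) : Set (Matrix (Fin p) (Fin q) ℝ) :=
  {D | ∃ (r : ℕ) (U : Matrix (Fin p) (Fin r) ℝ) (σ : Fin r → ℝ) (W : Matrix (Fin q) (Fin r) ℝ),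
    U.transpose * U = 1 ∧ W.transpose * W = 1 ∧ (∀ i, 0 < σ i) ∧
    M = U * Matrix.diagonal σ * W.transpose ∧ D = -(U * W.transpose)}

/-- Muon-Signum: for almost every `t ≥ 0`, with `m_t = (M_1(t), …, M_K(t), m^u_t)` the momentum
estimate, every `W_k` follows Muon, `dW_k/dt = -η(t) U_k V_kᵀ` with `M_k(t) = U_k Σ_k V_kᵀ`, and
`u` follows Signum, `du/dt ∈ η(t) · argmin_{‖v‖_∞ = 1} ⟨v, m^u_t⟩`, with the same schedule. -/
structure IsMuonSignum (ℒ : Params rows cols n → ℝ) (c : ℝ) (η : ℝ → ℝ)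
    (θ g : ℝ → Params rows cols n) : Prop where
  setup : IsMomentumSetup ℒ c η θ g
  update : ∀ᵐ t ∂(volume.restrict (Ici (0 : ℝ))), ∃ v : Params rows cols n,
    HasDerivAt θ (η t • v) t ∧
    (∀ k, matPart v k ∈ muonDirections (matPart (momentum c g t) k)) ∧
    vecPart v ∈ steepestDirections linftyNorm (vecPart (momentum c g t))

end Blocks

end MuonSignum

end

/-! Part 1 is duality. The unit ball of the hybrid norm is the product of the unit balls of the
blocks, and the inner product is the sum over the blocks, so a linear form is minimized block by
block. If M = UΣVᵀ, pairing A with M weights the diagonal of UᵀAV by Σ. On the spectral unit ball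
these entries are at least -1, and -UVᵀ attains -1 in all of them (`muonDirections_spec`).

Part 2 holds for every norm N (`IsNormalizedMSD.exists_isKKTPoint`). Write F_i = y_i f(x_i; ·), let
kbar_i be the limit of the subgradients of F_i divided by N^{L-1}, and put q_i = e^{-φ(F_i)} φ'(F_i)
N^{L-1}, Q = Σ q_i. The arc moves at N-speed η, so N = O(t^{1/L}), and η = o(t^{1/L-1}) gives
N^{L-1} η → 0. By the chain rule along the arc, the margins F_i and the log q_i then vary at a speed
tending to 0, too slowly for the exponentially fading memory of the momentum to matter: g and m both
equal -Σ q_i kbar_i up to o(Q) (`momentum_asymptotics`).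

So -log ℒ grows at a rate close to η ‖m‖_*/ℒ, where ‖·‖_* is the dual norm. Let γ = min F_i(θbar).
Euler's identity gives ‖m‖_* ≥ (Lγ - o(1)) Q; with ∫η = ∞ this forces ℒ → 0, N → ∞, F_i → ∞ and
φ'(F_i) → β = sup φ'. If ‖m‖_*/Q stayed above Lγ by a fixed amount, -log ℒ would outgrow βγ N^L; but
it is at most φ of the smallest margin, hence at most (βγ + o(1)) N^L. Therefore ‖m‖_* ≤ (Lγ + o(1))
Q at arbitrarily late times (`exists_inner_momentum_le`).

A limit λ of q/Q along such times satisfies ‖Σ λ_i kbar_i‖_* ≤ Lγ. Pairing with θbar gives Σ λ_i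
F_i(θbar) ≤ γ, hence equality. This is complementary slackness, and it also makes a multiple of Σ
λ_i kbar_i a subgradient of ½N² (`exists_multipliers`, `IsNorm.mem_clarkeSubdiff_half_sq`). -/

namespace MuonSignum

/-! ### Norms on a finite-dimensional Euclidean space -/

section NormFacts

variable {V : Type*} [NormedAddCommGroup V] [InnerProductSpace ℝ V]

theorem IsNorm.map_zero {N : V → ℝ} (hN : IsNorm N) : N 0 = 0 := by
  simpa using hN.smul 0 0

theorem IsNorm.map_neg {N : V → ℝ} (hN : IsNorm N) (v : V) : N (-v) = N v := by
  simpa using hN.smul (-1) v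

theorem IsNorm.smul_of_nonneg {N : V → ℝ} (hN : IsNorm N) {a : ℝ} (ha : 0 ≤ a) (v : V) :
    N (a • v) = a * N v := by
  rw [hN.smul, abs_of_nonneg ha]

theorem IsNorm.abs_sub_le {N : V → ℝ} (hN : IsNorm N) (v w : V) : |N v - N w| ≤ N (v - w) := by
  have h1 := hN.triangle (v - w) w
  have h2 := hN.triangle (w - v) v
  rw [← neg_sub, hN.map_neg] at h2
  simp only [sub_add_cancel, neg_sub] at h1 h2
  rw [abs_le]; constructor
  · have h3 : N (-(v - w) + v) ≤ N (v - w) + N v := by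
      have := hN.triangle (-(v - w)) v; rwa [hN.map_neg] at this
    simp only [neg_sub, sub_add_cancel] at h3
    linarith
  · linarith

theorem IsNorm.pos {N : V → ℝ} (hN : IsNorm N) {v : V} (hv : v ≠ 0) : 0 < N v :=
  lt_of_le_of_ne (hN.nonneg v) fun h => hv (hN.eq_zero_of v h.symm)

theorem IsNorm.sum_le {N : V → ℝ} (hN : IsNorm N) {ι : Type*} (s : Finset ι) (u : ι → V) :
    N (∑ i ∈ s, u i) ≤ ∑ i ∈ s, N (u i) := by
  classical
  induction s using Finset.induction_on with
  | empty => simp [hN.map_zero]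
  | insert i s hi ih =>
    rw [Finset.sum_insert hi, Finset.sum_insert hi]
    exact (hN.triangle _ _).trans (by gcongr)

variable [FiniteDimensional ℝ V]

theorem IsNorm.exists_le_mul_norm {N : V → ℝ} (hN : IsNorm N) :
    ∃ C, 0 < C ∧ ∀ v, N v ≤ C * ‖v‖ := by
  let b := stdOrthonormalBasis ℝ V
  have h0 : 0 ≤ ∑ i, N (b i) := Finset.sum_nonneg fun i _ => hN.nonneg (b i)
  refine ⟨∑ i, N (b i) + 1, by linarith, fun v => ?_⟩
  calc N v = N (∑ i, inner ℝ (b i) v • b i) := by rw [b.sum_repr']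
    _ ≤ ∑ i, N (inner ℝ (b i) v • b i) := hN.sum_le _ _
    _ ≤ ∑ i, ‖v‖ * N (b i) := by
        gcongr with i
        rw [hN.smul]
        gcongr
        · exact hN.nonneg _
        · simpa using abs_real_inner_le_norm (b i) v
    _ = (∑ i, N (b i)) * ‖v‖ := by rw [← Finset.mul_sum, mul_comm]
    _ ≤ _ := by gcongr; linarith

theorem IsNorm.exists_lipschitzWith {N : V → ℝ} (hN : IsNorm N) : ∃ C, LipschitzWith C N := by
  obtain ⟨C, hC, h⟩ := hN.exists_le_mul_norm
  refine ⟨⟨C, hC.le⟩, LipschitzWith.of_dist_le_mul fun v w => ?_⟩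
  rw [Real.dist_eq, dist_eq_norm]
  exact (hN.abs_sub_le v w).trans (h _)

theorem IsNorm.continuous {N : V → ℝ} (hN : IsNorm N) : Continuous N :=
  hN.exists_lipschitzWith.choose_spec.continuous

/-- By compactness `N` attains a positive minimum on the Euclidean unit sphere; its inverse is the
constant. The trivial space, where the sphere is empty, is treated apart. -/
theorem IsNorm.exists_norm_le_mul {N : V → ℝ} (hN : IsNorm N) :
    ∃ C, 0 < C ∧ ∀ v, ‖v‖ ≤ C * N v := by
  by_cases hV : ∃ v : V, v ≠ 0
  · obtain ⟨v₀, hv₀⟩ := hV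
    have hne : (Metric.sphere (0 : V) 1).Nonempty :=
      ⟨‖v₀‖⁻¹ • v₀, by simp [norm_smul, hv₀]⟩
    obtain ⟨w, hw, hmin⟩ := (isCompact_sphere (0 : V) 1).exists_isMinOn hne hN.continuous.continuousOn
    have hw1 : ‖w‖ = 1 := by simpa using hw
    have hw0 : w ≠ 0 := by rintro rfl; simp at hw1
    have hp := hN.pos hw0
    refine ⟨(N w)⁻¹, by positivity, fun v => ?_⟩
    rcases eq_or_ne v 0 with rfl | hv
    · simp [hN.map_zero]
    have h1 : N w ≤ N (‖v‖⁻¹ • v) := hmin (by simp [norm_smul, hv])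
    rw [hN.smul_of_nonneg (by positivity)] at h1
    have hv' : 0 < ‖v‖ := norm_pos_iff.2 hv
    rw [inv_mul_eq_div, le_div_iff₀ hp]
    rw [inv_mul_eq_div, le_div_iff₀ hv'] at h1
    linarith
  · push Not at hV
    exact ⟨1, one_pos, fun v => by simp [hV v, hN.map_zero]⟩

end NormFacts

/-! ### Compactness of convex hulls -/

section ConvexHull

/-- In a finite-dimensional space the convex hull of a compact set is compact. -/
theorem isCompact_convexHull_of_isCompact {V : Type*} [NormedAddCommGroup V] [NormedSpace ℝ V]
    [FiniteDimensional ℝ V] {s : Set V} (hs : IsCompact s) : IsCompact (convexHull ℝ s) := by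
  -- Carathéodory: at most dim V + 1 affinely independent points suffice, so the hull is a finite
  -- union of continuous images of the compact sets simplex × sʲ, with j ≤ dim V + 1.
  have key : convexHull ℝ s = ⋃ j ∈ Finset.range (Module.finrank ℝ V + 2),
      (fun p : (Fin j → ℝ) × (Fin j → V) => ∑ i, p.1 i • p.2 i) ''
        (stdSimplex ℝ (Fin j) ×ˢ Set.univ.pi fun _ => s) := by
    apply Subset.antisymm
    · intro x hx
      obtain ⟨ι, _, z, w, hz, hi, hw, hw1, hx⟩ := eq_pos_convex_span_of_mem_convexHull hx
      have hc : Fintype.card ι < Module.finrank ℝ V + 2 := by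
        have h1 := hi.card_le_finrank_succ
        have h2 := Submodule.finrank_le (vectorSpan ℝ (range z))
        omega
      let e := Fintype.equivFin ι
      refine mem_iUnion₂.2 ⟨Fintype.card ι, Finset.mem_range.2 hc, (w ∘ e.symm, z ∘ e.symm),
        ⟨⟨fun i => (hw _).le, ?_⟩, fun i _ => hz (mem_range_self _)⟩, ?_⟩
      · rw [← hw1]; exact e.symm.sum_comp w
      · rw [← hx]; exact e.symm.sum_comp fun i => w i • z i
    · refine iUnion₂_subset fun j _ => ?_
      rintro _ ⟨p, ⟨⟨h0, h1⟩, h2⟩, rfl⟩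
      exact (convex_convexHull ℝ s).sum_mem (fun i _ => h0 i) h1
        fun i _ => subset_convexHull ℝ s (h2 i trivial)
  rw [key]
  refine Finset.isCompact_biUnion _ fun j _ => ?_
  refine ((isCompact_stdSimplex ℝ (Fin j)).prod (isCompact_univ_pi fun _ => hs)).image ?_
  fun_prop

end ConvexHull

/-! ### Clarke subdifferentials, homogeneity and convex subgradients -/

section Clarke

variable {V : Type*} [NormedAddCommGroup V] [InnerProductSpace ℝ V] [CompleteSpace V]

/-- The limits of gradients of `F` along sequences converging to `w`. -/
def limitingGradients (F : V → ℝ) (w : V) : Set V :=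
  {l | ∃ s : ℕ → V, Tendsto s atTop (𝓝 w) ∧ (∀ k, DifferentiableAt ℝ F (s k)) ∧
    Tendsto (fun k => gradient F (s k)) atTop (𝓝 l)}

theorem convex_clarkeSubdiff (F : V → ℝ) (w : V) : Convex ℝ (clarkeSubdiff F w) :=
  convex_convexHull _ _

theorem clarkeSubdiff_subset_of_convex {F : V → ℝ} {w : V} {C : Set V} (hC : Convex ℝ C)
    (h : limitingGradients F w ⊆ C) : clarkeSubdiff F w ⊆ C :=
  convexHull_min h hC

/-- As the closure of the graph of the gradient, the limiting gradients have closed graph without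
any diagonal extraction. -/
theorem mem_limitingGradients_iff {F : V → ℝ} {w l : V} :
    l ∈ limitingGradients F w ↔
      (w, l) ∈ closure {p : V × V | DifferentiableAt ℝ F p.1 ∧ gradient F p.1 = p.2} := by
  rw [mem_closure_iff_seq_limit]
  constructor
  · rintro ⟨s, hs, hd, hl⟩
    exact ⟨fun k => (s k, gradient F (s k)), fun k => ⟨hd k, rfl⟩, hs.prodMk_nhds hl⟩
  · rintro ⟨p, hp, hl⟩
    rw [Prod.tendsto_iff] at hl
    exact ⟨fun k => (p k).1, hl.1, fun k => (hp k).1, by simpa only [(hp _).2] using hl.2⟩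

theorem mem_limitingGradients_of_tendsto {F : V → ℝ} {w : ℕ → V} {l : ℕ → V} {w₀ l₀ : V}
    (h : ∀ k, l k ∈ limitingGradients F (w k)) (hw : Tendsto w atTop (𝓝 w₀))
    (hl : Tendsto l atTop (𝓝 l₀)) : l₀ ∈ limitingGradients F w₀ := by
  simp only [mem_limitingGradients_iff] at h ⊢
  exact isClosed_closure.mem_of_tendsto (hw.prodMk_nhds hl) (Eventually.of_forall h)

theorem norm_gradient_le_of_lipschitzOnWith {F : V → ℝ} {w : V} {K : NNReal} {U : Set V}
    (hU : U ∈ 𝓝 w) (hF : LipschitzOnWith K F U) : ‖gradient F w‖ ≤ K := by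
  rw [gradient, LinearIsometryEquiv.norm_map]
  exact norm_fderiv_le_of_lipschitzOn ℝ hU hF

theorem norm_le_of_mem_limitingGradients {F : V → ℝ} {w l : V} {K : NNReal} {U : Set V}
    (hU : IsOpen U) (hw : w ∈ U) (hF : LipschitzOnWith K F U) (hl : l ∈ limitingGradients F w) :
    ‖l‖ ≤ K := by
  obtain ⟨s, hs, -, hl⟩ := hl
  refine le_of_tendsto hl.norm ?_
  filter_upwards [hs.eventually (hU.mem_nhds hw)] with k hk
  exact norm_gradient_le_of_lipschitzOnWith (hU.mem_nhds hk) hF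

theorem norm_le_of_mem_clarkeSubdiff {F : V → ℝ} {w l : V} {K : NNReal} {U : Set V}
    (hU : IsOpen U) (hw : w ∈ U) (hF : LipschitzOnWith K F U) (hl : l ∈ clarkeSubdiff F w) :
    ‖l‖ ≤ K := by
  have : clarkeSubdiff F w ⊆ Metric.closedBall 0 K :=
    clarkeSubdiff_subset_of_convex (convex_closedBall _ _) fun l hl => by
      simpa using norm_le_of_mem_limitingGradients hU hw hF hl
  simpa using this hl

theorem _root_.LocallyLipschitz.exists_isOpen_lipschitzOnWith {E : Type*} [PseudoEMetricSpace E]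
    {F : E → ℝ} (hF : LocallyLipschitz F) (w : E) : ∃ K : NNReal, ∃ U, IsOpen U ∧ w ∈ U ∧
      LipschitzOnWith K F U := by
  obtain ⟨K, t, ht, h⟩ := hF w
  obtain ⟨U, hUt, hU, hw⟩ := mem_nhds_iff.1 ht
  exact ⟨K, U, hU, hw, h.mono hUt⟩

/-- Clarke subgradients are bounded along a compact set. -/
theorem exists_norm_le_of_isCompact {F : V → ℝ} (hF : LocallyLipschitz F) {s : Set V}
    (hs : IsCompact s) : ∃ C : ℝ, ∀ w ∈ s, ∀ l ∈ clarkeSubdiff F w, ‖l‖ ≤ C := by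
  choose K U hU hwU hK using fun w => hF.exists_isOpen_lipschitzOnWith w
  obtain ⟨t, ht⟩ := hs.elim_finite_subcover U hU fun w _ => mem_iUnion.2 ⟨w, hwU w⟩
  refine ⟨∑ a ∈ t, (K a : ℝ), fun w hw l hl => ?_⟩
  obtain ⟨a, ha, hwa⟩ := mem_iUnion₂.1 (ht hw)
  exact (norm_le_of_mem_clarkeSubdiff (hU a) hwa (hK a) hl).trans
    (Finset.single_le_sum (f := fun a => (K a : ℝ)) (fun _ _ => NNReal.coe_nonneg _) ha)

theorem isCompact_limitingGradients [FiniteDimensional ℝ V] {F : V → ℝ}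
    (hF : LocallyLipschitz F) (w : V) : IsCompact (limitingGradients F w) := by
  obtain ⟨K, U, hU, hw, hK⟩ := hF.exists_isOpen_lipschitzOnWith w
  refine (isCompact_closedBall (0 : V) K).of_isClosed_subset ?_ fun l hl => by
    simpa using norm_le_of_mem_limitingGradients hU hw hK hl
  refine isSeqClosed_iff_isClosed.1 fun l l₀ h hl =>
    mem_limitingGradients_of_tendsto h tendsto_const_nhds hl

theorem isCompact_clarkeSubdiff [FiniteDimensional ℝ V] {F : V → ℝ}
    (hF : LocallyLipschitz F) (w : V) : IsCompact (clarkeSubdiff F w) :=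
  isCompact_convexHull_of_isCompact (isCompact_limitingGradients hF w)

/-- A criterion for membership in the Clarke subdifferential by its support function. -/
theorem mem_clarkeSubdiff_of_support [FiniteDimensional ℝ V] {F : V → ℝ}
    (hF : LocallyLipschitz F) {w k : V}
    (h : ∀ d : V, ∃ l ∈ limitingGradients F w, inner ℝ k d ≤ inner ℝ l d) :
    k ∈ clarkeSubdiff F w := by
  by_contra hk
  -- Hahn–Banach separates `k` from the closed convex subdifferential; the Riesz vector of the
  -- separating functional is the direction that contradicts `h`.
  obtain ⟨f, u, hu, hfu⟩ := geometric_hahn_banach_closed_point (convex_clarkeSubdiff F w)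
    (isCompact_clarkeSubdiff hF w).isClosed hk
  obtain ⟨l, hl, hle⟩ := h ((InnerProductSpace.toDual ℝ V).symm f)
  have h1 := hu l (subset_convexHull ℝ _ hl)
  rw [real_inner_comm, real_inner_comm _ l, InnerProductSpace.toDual_symm_apply,
    InnerProductSpace.toDual_symm_apply] at hle
  linarith

/-- The Clarke subdifferential of a locally Lipschitz function has closed graph. -/
theorem mem_clarkeSubdiff_of_tendsto [FiniteDimensional ℝ V] {F : V → ℝ}
    (hF : LocallyLipschitz F) {w : ℕ → V} {l : ℕ → V} {w₀ l₀ : V}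
    (h : ∀ k, l k ∈ clarkeSubdiff F (w k)) (hw : Tendsto w atTop (𝓝 w₀))
    (hl : Tendsto l atTop (𝓝 l₀)) : l₀ ∈ clarkeSubdiff F w₀ := by
  refine mem_clarkeSubdiff_of_support hF fun d => ?_
  -- A linear form on a convex hull is dominated by its value at some generator: otherwise the hull,
  -- and with it `l k`, would lie in an open half-space bounded by `l k` itself.
  have hex : ∀ k, ∃ x ∈ limitingGradients F (w k), inner ℝ (l k) d ≤ inner ℝ x d := by
    intro k
    by_contra! hcon
    have : clarkeSubdiff F (w k) ⊆ {x | inner ℝ x d < inner ℝ (l k) d} :=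
      clarkeSubdiff_subset_of_convex
        (convex_halfSpace_lt (f := fun x => inner ℝ x d) ⟨fun x y => inner_add_left x y d,
          fun c x => real_inner_smul_left x d c⟩ _) fun x hx => hcon x hx
    exact lt_irrefl (inner ℝ (l k) d) (this (h k))
  choose x hx hxd using hex
  obtain ⟨K, U, hU, hwU, hK⟩ := hF.exists_isOpen_lipschitzOnWith w₀
  obtain ⟨k₀, hk₀⟩ := eventually_atTop.1 (hw.eventually (hU.mem_nhds hwU))
  have hb : ∀ k, x (k + k₀) ∈ Metric.closedBall (0 : V) K := fun k => by
    simpa using norm_le_of_mem_limitingGradients hU (hk₀ (k + k₀) (by omega)) hK (hx _)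
  obtain ⟨x₀, -, ψ, hψ, hx₀⟩ := (isCompact_closedBall (0 : V) K).tendsto_subseq hb
  have hψ' : Tendsto (fun k => ψ k + k₀) atTop atTop :=
    tendsto_atTop_mono (fun k => Nat.le_add_right _ _) hψ.tendsto_atTop
  refine ⟨x₀, mem_limitingGradients_of_tendsto (fun k => hx (ψ k + k₀)) (hw.comp hψ') hx₀, ?_⟩
  exact le_of_tendsto_of_tendsto ((hl.comp hψ').inner tendsto_const_nhds)
    (hx₀.inner tendsto_const_nhds) (Eventually.of_forall fun k => hxd _)

theorem mem_limitingGradients_of_differentiableAt {F : V → ℝ} {w : V}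
    (h : DifferentiableAt ℝ F w) : gradient F w ∈ limitingGradients F w :=
  ⟨fun _ => w, tendsto_const_nhds, fun _ => h, tendsto_const_nhds⟩

theorem clarkeSubdiff_subset_singleton {F : V → ℝ} (hF : ContDiff ℝ 1 F) (w : V) :
    clarkeSubdiff F w ⊆ {gradient F w} := by
  refine clarkeSubdiff_subset_of_convex (convex_singleton _) ?_
  rintro l ⟨s, hs, -, hl⟩
  have hc : Continuous (gradient F) :=
    (LinearIsometryEquiv.continuous _).comp (hF.continuous_fderiv one_ne_zero)
  exact tendsto_nhds_unique hl ((hc.tendsto w).comp hs)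

theorem hasDerivAt_inner_gradient {F : V → ℝ} {γ : ℝ → V} {v : V} {t : ℝ}
    (hF : DifferentiableAt ℝ F (γ t)) (hγ : HasDerivAt γ v t) :
    HasDerivAt (fun s => F (γ s)) (inner ℝ (gradient F (γ t)) v) t := by
  have := hF.hasFDerivAt.comp_hasDerivAt t hγ
  rwa [← hF.hasGradientAt.fderiv_apply]

/-- Euler's identity for Clarke subgradients of a positively homogeneous function. -/
theorem inner_eq_of_mem_clarkeSubdiff {F : V → ℝ} {L : ℝ} (hF : Continuous F)
    (hh : ∀ (w : V) (a : ℝ), 0 < a → F (a • w) = a ^ L * F w) {w l : V}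
    (hl : l ∈ clarkeSubdiff F w) : inner ℝ l w = L * F w := by
  have hconv : Convex ℝ {l : V | inner ℝ l w = L * F w} :=
    convex_hyperplane (f := fun x => inner ℝ x w) ⟨fun x y => inner_add_left x y w,
      fun c x => real_inner_smul_left x w c⟩ _
  refine clarkeSubdiff_subset_of_convex hconv ?_ hl
  rintro l ⟨s, hs, hd, hl⟩
  -- Differentiate `a ↦ F (a • s k)` at `a = 1` in two ways.
  have heq : ∀ k, inner ℝ (gradient F (s k)) (s k) = L * F (s k) := by
    intro k
    have h1 : HasDerivAt (fun a : ℝ => F (a • s k)) (inner ℝ (gradient F (s k)) (s k)) 1 := by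
      have hγ : HasDerivAt (fun a : ℝ => a • s k) (s k) 1 := by
        simpa using (hasDerivAt_id (1 : ℝ)).smul_const (s k)
      have := hasDerivAt_inner_gradient (γ := fun a : ℝ => a • s k) (t := 1)
        (by simpa using hd k) hγ
      simpa using this
    have h2 : HasDerivAt (fun a : ℝ => a ^ L * F (s k)) (L * F (s k)) 1 := by
      simpa using (Real.hasDerivAt_rpow_const (p := L) (Or.inl one_ne_zero)).mul_const (F (s k))
    refine h1.unique (h2.congr_of_eventuallyEq ?_)
    filter_upwards [lt_mem_nhds (zero_lt_one' ℝ)] with a ha using hh _ _ ha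
  refine tendsto_nhds_unique (hl.inner hs) ?_
  simpa only [heq, Function.comp_def] using ((hF.tendsto w).comp hs).const_mul L

/-- Homogeneity says F = a^L F(a⁻¹ ·); the chain rule for the right-hand side loses one power of a.
-/
theorem gradient_smul_of_homogeneous {F : V → ℝ} {L : ℝ}
    (hh : ∀ (w : V) (a : ℝ), 0 < a → F (a • w) = a ^ L * F w) {w : V} {a : ℝ} (ha : 0 < a)
    (hd : DifferentiableAt ℝ F w) :
    DifferentiableAt ℝ F (a • w) ∧ gradient F (a • w) = a ^ (L - 1) • gradient F w := by
  have hF : F = fun v => a ^ L * F (a⁻¹ • v) := by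
    funext v
    rw [← hh _ _ ha, smul_smul, mul_inv_cancel₀ ha.ne', one_smul]
  have h1 : HasFDerivAt (fun v : V => a⁻¹ • v) (a⁻¹ • ContinuousLinearMap.id ℝ V) (a • w) :=
    (hasFDerivAt_id (a • w)).const_smul a⁻¹
  have h2 : HasFDerivAt F (fderiv ℝ F w) (a⁻¹ • a • w) := by
    rw [smul_smul, inv_mul_cancel₀ ha.ne', one_smul]; exact hd.hasFDerivAt
  have h3 := (h2.comp (a • w) h1).const_mul (a ^ L)
  have h4 : HasGradientAt F (a ^ (L - 1) • gradient F w) (a • w) := by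
    rw [hasGradientAt_iff_hasFDerivAt]
    have h5 : (fun v => a ^ L * (F ∘ fun v => a⁻¹ • v) v) = F := hF.symm
    rw [h5] at h3
    refine h3.congr_fderiv ?_
    ext v
    change a ^ L * fderiv ℝ F w (a⁻¹ • v) = _
    rw [InnerProductSpace.toDual_apply_apply, real_inner_smul_left, map_smul,
      hd.hasGradientAt.fderiv_apply, Real.rpow_sub_one ha.ne', smul_eq_mul]
    ring
  exact ⟨h4.differentiableAt, h4.gradient⟩

theorem smul_mem_clarkeSubdiff {F : V → ℝ} {L : ℝ}
    (hh : ∀ (w : V) (a : ℝ), 0 < a → F (a • w) = a ^ L * F w) {w l : V} {a : ℝ} (ha : 0 < a)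
    (hl : l ∈ clarkeSubdiff F w) : a ^ (L - 1) • l ∈ clarkeSubdiff F (a • w) := by
  have hconv : Convex ℝ {l : V | a ^ (L - 1) • l ∈ clarkeSubdiff F (a • w)} :=
    (convex_clarkeSubdiff F (a • w)).linear_preimage (LinearMap.lsmul ℝ V (a ^ (L - 1)))
  refine clarkeSubdiff_subset_of_convex hconv ?_ hl
  rintro l ⟨s, hs, hd, hl⟩
  refine subset_convexHull ℝ _ ⟨fun k => a • s k, hs.const_smul a,
    fun k => (gradient_smul_of_homogeneous hh ha (hd k)).1, ?_⟩
  simp only [(gradient_smul_of_homogeneous hh ha (hd _)).2]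
  exact hl.const_smul _

theorem _root_.ConvexOn.sub_le_inner_gradient {F : V → ℝ} (hF : ConvexOn ℝ univ F) {w : V}
    (hd : DifferentiableAt ℝ F w) (v : V) : F w - F v ≤ inner ℝ (gradient F w) (w - v) := by
  have hc : ConvexOn ℝ univ (fun a : ℝ => F (AffineMap.lineMap w v a)) := by
    simpa using! hF.comp_affineMap (AffineMap.lineMap w v)
  have h1 : HasDerivAt (fun a : ℝ => F (AffineMap.lineMap w v a))
      (inner ℝ (gradient F w) (v - w)) 0 := by
    have := hasDerivAt_inner_gradient (F := F) (γ := fun a : ℝ => AffineMap.lineMap w v a) (t := 0)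
      (by simpa using hd) AffineMap.hasDerivAt_lineMap
    simpa using this
  have h2 := hc.le_slope_of_hasDerivAt (mem_univ _) (mem_univ (1 : ℝ)) one_pos h1
  simp only [slope_def_field, AffineMap.lineMap_apply_one, AffineMap.lineMap_apply_zero, sub_zero,
    div_one] at h2
  rw [← neg_sub v w, inner_neg_right]
  linarith

omit [CompleteSpace V] in
theorem IsNorm.convexOn {N : V → ℝ} (hN : IsNorm N) : ConvexOn ℝ univ N :=
  ⟨convex_univ, fun v _ w _ a b ha hb _ => by
    simpa [hN.smul_of_nonneg ha, hN.smul_of_nonneg hb] using hN.triangle (a • v) (b • w)⟩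

omit [CompleteSpace V] in
-- Rademacher's theorem, and sets of full Haar measure are dense.
theorem IsNorm.dense_differentiableAt [FiniteDimensional ℝ V] {N : V → ℝ} (hN : IsNorm N) :
    Dense {v | DifferentiableAt ℝ N v} := by
  let : MeasurableSpace V := borel V
  have : BorelSpace V := ⟨rfl⟩
  obtain ⟨C, hC⟩ := hN.exists_lipschitzWith
  exact Measure.dense_of_ae (μ := Measure.addHaar) hC.ae_differentiableAt

/-- The convex subgradients of `½ N²` are Clarke subgradients. -/
theorem IsNorm.mem_clarkeSubdiff_half_sq [FiniteDimensional ℝ V] {N : V → ℝ} (hN : IsNorm N)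
    {k w : V} (hle : ∀ v, inner ℝ k v ≤ N w * N v) (heq : inner ℝ k w = N w ^ 2) :
    k ∈ clarkeSubdiff (fun v => (1 / 2 : ℝ) * N v ^ 2) w := by
  set F : V → ℝ := fun v => (1 / 2 : ℝ) * N v ^ 2 with hFdef
  have hconv : ConvexOn ℝ univ F := by
    have := (hN.convexOn.pow (fun v _ => hN.nonneg v) 2).smul (c := (1 / 2 : ℝ)) (by norm_num)
    simpa only [smul_eq_mul] using! this
  have hsq : ContDiff ℝ 1 fun r : ℝ => (1 / 2 : ℝ) * r ^ 2 := by fun_prop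
  have hlip : LocallyLipschitz F :=
    hsq.locallyLipschitz.comp hN.exists_lipschitzWith.choose_spec.locallyLipschitz
  -- The convex subgradient inequality, from N(w)N(v) ≤ (N(w)² + N(v)²)/2.
  have hsub : ∀ v, inner ℝ k (v - w) ≤ F v - F w := fun v => by
    rw [inner_sub_right, heq]
    have := hle v
    simp only [hFdef]
    nlinarith [sq_nonneg (N w - N v)]
  refine mem_clarkeSubdiff_of_support hlip fun d => ?_
  -- Move `w + τ • d` by less than τ² to a point of differentiability. Measured in units of τ the
  -- direction changes by at most τ, so `e → d`.
  have hex : ∀ j : ℕ, ∃ e : V, ‖e - d‖ ≤ 1 / ((j : ℝ) + 1) ∧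
      DifferentiableAt ℝ F (w + (1 / ((j : ℝ) + 1)) • e) := by
    intro j
    set τ : ℝ := 1 / ((j : ℝ) + 1) with hτ
    have hτ0 : 0 < τ := by positivity
    obtain ⟨x, hx, hxd⟩ := hN.dense_differentiableAt.exists_dist_lt (w + τ • d)
      (show 0 < τ * τ by positivity)
    have hxe : w + τ • (τ⁻¹ • (x - w)) = x := by
      rw [smul_smul, mul_inv_cancel₀ hτ0.ne', one_smul, add_sub_cancel]
    refine ⟨τ⁻¹ • (x - w), ?_, ?_⟩
    · rw [dist_comm, dist_eq_norm] at hxd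
      have : τ⁻¹ • (x - w) - d = τ⁻¹ • (x - (w + τ • d)) := by
        rw [← sub_sub, smul_sub τ⁻¹ (x - w), smul_smul, inv_mul_cancel₀ hτ0.ne', one_smul]
      rw [this, norm_smul, Real.norm_of_nonneg (by positivity), inv_mul_le_iff₀ hτ0]
      exact hxd.le
    · rw [hxe]
      exact (DifferentiableAt.pow hx 2).const_mul _
  choose e he hdiff using hex
  have hτ := tendsto_one_div_add_atTop_nhds_zero_nat (𝕜 := ℝ)
  have hed : Tendsto e atTop (𝓝 d) :=
    tendsto_iff_norm_sub_tendsto_zero.2 (squeeze_zero (fun _ => norm_nonneg _) he hτ)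
  have hx : Tendsto (fun j : ℕ => w + (1 / ((j : ℝ) + 1)) • e j) atTop (𝓝 w) := by
    simpa using (hτ.smul hed).const_add w
  -- At x = w + τe: τ⟨k, e⟩ ≤ F(x) - F(w) ≤ τ⟨∇F(x), e⟩. A limit of the bounded gradients ∇F(x) is
  -- then the element required by the support criterion in direction `d`.
  have hmono : ∀ j : ℕ, inner ℝ k (e j) ≤
      inner ℝ (gradient F (w + (1 / ((j : ℝ) + 1)) • e j)) (e j) := by
    intro j
    have h1 := hconv.sub_le_inner_gradient (hdiff j) w
    have h2 := hsub (w + (1 / ((j : ℝ) + 1)) • e j)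
    rw [add_sub_cancel_left, real_inner_smul_right] at h1 h2
    exact le_of_mul_le_mul_left (h2.trans h1) (by positivity)
  obtain ⟨K, U, hU, hwU, hK⟩ := hlip.exists_isOpen_lipschitzOnWith w
  obtain ⟨j₀, hj₀⟩ := eventually_atTop.1 (hx.eventually (hU.mem_nhds hwU))
  have hb : ∀ j, gradient F (w + (1 / (((j + j₀ : ℕ) : ℝ) + 1)) • e (j + j₀)) ∈
      Metric.closedBall (0 : V) K := fun j => by
    simpa using norm_gradient_le_of_lipschitzOnWith (hU.mem_nhds (hj₀ (j + j₀) (by omega))) hK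
  obtain ⟨l, -, ψ, hψ, hl⟩ := (isCompact_closedBall (0 : V) K).tendsto_subseq hb
  have hψ' : Tendsto (fun k => ψ k + j₀) atTop atTop :=
    tendsto_atTop_mono (fun k => Nat.le_add_right _ _) hψ.tendsto_atTop
  refine ⟨l, ⟨fun j => w + (1 / (((ψ j + j₀ : ℕ) : ℝ) + 1)) • e (ψ j + j₀), hx.comp hψ',
    fun j => hdiff _, hl⟩, ?_⟩
  exact le_of_tendsto_of_tendsto (tendsto_const_nhds.inner (hed.comp hψ'))
    (hl.inner (hed.comp hψ')) (Eventually.of_forall fun j => hmono _)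

end Clarke

/-! ### Absolutely continuous functions along arcs -/

section AbsolutelyContinuous

theorem _root_.AbsolutelyContinuousOnInterval.of_dist_le {E : Type*} [PseudoMetricSpace E]
    {u : ℝ → E} {Φ : ℝ → ℝ} {a b : ℝ} (hΦ : AbsolutelyContinuousOnInterval Φ a b) (K : ℝ)
    (h : ∀ s ∈ uIcc a b, ∀ t ∈ uIcc a b, dist (u s) (u t) ≤ K * dist (Φ s) (Φ t)) :
    AbsolutelyContinuousOnInterval u a b := by
  refine squeeze_zero' (Eventually.of_forall fun E => Finset.sum_nonneg fun i _ => dist_nonneg) ?_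
    (by simpa using Tendsto.const_mul K hΦ)
  filter_upwards [mem_inf_of_right (mem_principal_self _)] with E hE
  rw [Finset.mul_sum]
  exact Finset.sum_le_sum fun i hi => h _ (hE.1 i hi).1 _ (hE.1 i hi).2

/-- Comparison of absolutely continuous functions by their derivatives. -/
theorem _root_.AbsolutelyContinuousOnInterval.sub_le_sub {u v : ℝ → ℝ} {a b : ℝ} (hab : a ≤ b)
    (hu : AbsolutelyContinuousOnInterval u a b) (hv : AbsolutelyContinuousOnInterval v a b)
    (h : ∀ᵐ t, t ∈ Icc a b → deriv u t ≤ deriv v t) : u b - u a ≤ v b - v a := by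
  rw [← hu.integral_deriv_eq_sub, ← hv.integral_deriv_eq_sub]
  refine intervalIntegral.integral_mono_ae_restrict hab hu.intervalIntegrable_deriv
    hv.intervalIntegrable_deriv ?_
  rw [EventuallyLE, ae_restrict_iff' measurableSet_Icc]
  exact h

variable {V : Type*} [NormedAddCommGroup V] [InnerProductSpace ℝ V] [CompleteSpace V]

omit [CompleteSpace V] in
-- The arc length ∫‖v‖ dominates the increments of θ. It is a real absolutely continuous function,
-- so the scalar theory applies to Lipschitz functions of θ.
theorem IsArc.exists_dist_le {θ : ℝ → V} (hθ : IsArc θ) {S : ℝ} (hS : 0 ≤ S) :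
    ∃ Φ : ℝ → ℝ, AbsolutelyContinuousOnInterval Φ 0 S ∧
      ∀ s ∈ uIcc 0 S, ∀ t ∈ uIcc 0 S, dist (θ s) (θ t) ≤ dist (Φ s) (Φ t) := by
  obtain ⟨v, hv, hθv⟩ := hθ
  have hn := fun t ht => (hv t ht).norm
  refine ⟨fun t => ∫ s in (0 : ℝ)..t, ‖v s‖,
    (hn S hS).absolutelyContinuousOnInterval_intervalIntegral (by simp), fun s hs t ht => ?_⟩
  rw [uIcc_of_le hS] at hs ht
  rw [hθv s hs.1, hθv t ht.1, dist_add_left, dist_eq_norm, Real.dist_eq,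
    intervalIntegral.integral_interval_sub_left (hv s hs.1) (hv t ht.1),
    intervalIntegral.integral_interval_sub_left (hn s hs.1) (hn t ht.1)]
  exact intervalIntegral.norm_integral_le_abs_integral_norm

omit [CompleteSpace V] in
theorem IsArc.continuousOn {θ : ℝ → V} (hθ : IsArc θ) {S : ℝ} (hS : 0 ≤ S) :
    ContinuousOn θ (Icc 0 S) := by
  obtain ⟨Φ, hΦ, h⟩ := hθ.exists_dist_le hS
  rw [← uIcc_of_le hS]
  exact (hΦ.of_dist_le 1 (by simpa using h)).continuousOn

omit [CompleteSpace V] in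
theorem IsArc.absolutelyContinuousOnInterval_comp {θ : ℝ → V} (hθ : IsArc θ) {H : V → ℝ}
    (hH : LocallyLipschitz H) {a b : ℝ} (ha : 0 ≤ a) (hb : 0 ≤ b) :
    AbsolutelyContinuousOnInterval (fun t => H (θ t)) a b := by
  have hS : 0 ≤ max a b := ha.trans (le_max_left _ _)
  obtain ⟨Φ, hΦ, h⟩ := hθ.exists_dist_le hS
  have hcomp : IsCompact (θ '' uIcc 0 (max a b)) :=
    isCompact_uIcc.image_of_continuousOn (by rw [uIcc_of_le hS]; exact hθ.continuousOn hS)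
  obtain ⟨K, hK⟩ := hH.locallyLipschitzOn.exists_lipschitzOnWith_of_compact hcomp
  refine (hΦ.of_dist_le K fun s hs t ht => ?_).mono ?_
  · exact (hK.dist_le_mul _ (mem_image_of_mem _ hs) _ (mem_image_of_mem _ ht)).trans
      (by gcongr; exact h s hs t ht)
  · exact uIcc_subset_uIcc (mem_uIcc.2 (Or.inl ⟨ha, le_max_left _ _⟩))
      (mem_uIcc.2 (Or.inl ⟨hb, le_max_right _ _⟩))

omit [CompleteSpace V] in
theorem IsArc.ae_differentiableAt_comp {θ : ℝ → V} (hθ : IsArc θ) {H : V → ℝ}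
    (hH : LocallyLipschitz H) :
    ∀ᵐ t, 0 ≤ t → DifferentiableAt ℝ (fun s => H (θ s)) t := by
  have h : ∀ n : ℕ, ∀ᵐ t : ℝ, t ∈ uIcc 0 (n : ℝ) → DifferentiableAt ℝ (fun s => H (θ s)) t :=
    fun n => (hθ.absolutelyContinuousOnInterval_comp hH le_rfl n.cast_nonneg).ae_differentiableAt
  filter_upwards [ae_all_iff.2 h] with t ht h0
  obtain ⟨n, hn⟩ := exists_nat_ge t
  exact ht n (mem_uIcc.2 (Or.inl ⟨h0, hn⟩))

end AbsolutelyContinuous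

/-! ### The chain rule along arcs for Whitney stratifiable functions -/

section ChainRule

/-- For the set of times spent in a stratum this says that almost every such time is an accumulation
point of the set, which makes the velocity tangent to the stratum. -/
theorem countable_not_accPt (T : Set ℝ) : {t ∈ T | ¬AccPt t (𝓟 T)}.Countable := by
  have hsub : {t ∈ T | ¬AccPt t (𝓟 T)} ⊆ {t ∈ T | 𝓝[T ∩ Ioi t] t = ⊥} := by
    intro t ht
    have h := ht.2
    rw [accPt_principal_iff_nhdsWithin, not_neBot] at h
    have hsub : T ∩ Ioi t ⊆ T \ {t} := fun s hs => ⟨hs.1, (mem_Ioi.1 hs.2).ne'⟩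
    exact ⟨ht.1, le_bot_iff.1 ((nhdsWithin_mono _ hsub).trans h.le)⟩
  exact countable_setOfPred_isolated_right_within.mono hsub

variable {V : Type*} [NormedAddCommGroup V] [InnerProductSpace ℝ V]

theorem convex_normalSpace (M : Set V) (z : V) : Convex ℝ (normalSpace M z) := by
  intro v hv w hw a b _ _ _ u hu
  rw [inner_add_left, real_inner_smul_left, real_inner_smul_left, hv u hu, hw u hu]
  simp

variable [CompleteSpace V]

/-- The vector `(∇f(w), -1)` is normal to every subset of the graph of `f` at `(w, f(w))`. -/
theorem toLp_gradient_mem_normalSpace {f : V → ℝ} {w : V} (hf : DifferentiableAt ℝ f w)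
    {M : Set (WithLp 2 (V × ℝ))} (hM : M ⊆ range fun w : V => WithLp.toLp 2 (w, f w)) :
    WithLp.toLp 2 (gradient f w, (-1 : ℝ)) ∈ normalSpace M (WithLp.toLp 2 (w, f w)) := by
  intro u hu
  -- P vanishes on the graph, so its derivative maps the tangent cone of `M` into that of `{0}`,
  -- which is trivial. This derivative is the pairing with (∇f(w), -1).
  let P : WithLp 2 (V × ℝ) → ℝ := fun p => f p.fst - p.snd
  have hfst : HasFDerivAt (fun p : WithLp 2 (V × ℝ) => p.fst) (WithLp.fstL 2 ℝ V ℝ)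
      (WithLp.toLp 2 (w, f w)) := (WithLp.fstL 2 ℝ V ℝ).hasFDerivAt
  have hsnd : HasFDerivAt (fun p : WithLp 2 (V × ℝ) => p.snd) (WithLp.sndL 2 ℝ V ℝ)
      (WithLp.toLp 2 (w, f w)) := (WithLp.sndL 2 ℝ V ℝ).hasFDerivAt
  have hP : HasFDerivAt P (fderiv ℝ f w ∘L WithLp.fstL 2 ℝ V ℝ - WithLp.sndL 2 ℝ V ℝ)
      (WithLp.toLp 2 (w, f w)) :=
    (HasFDerivAt.comp (g := f) (WithLp.toLp 2 (w, f w)) hf.hasFDerivAt hfst).sub hsnd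
  have h1 := hP.hasFDerivWithinAt.mapsTo_tangent_cone (s := M) hu
  have hsub : P '' M ⊆ {0} := by
    rintro _ ⟨p, hp, rfl⟩
    obtain ⟨w', rfl⟩ := hM hp
    simp [P]
  have h2 := tangentConeAt_mono hsub h1
  have hnacc : ¬ AccPt (P (WithLp.toLp 2 (w, f w))) (𝓟 {(0 : ℝ)}) := by
    have hP0 : P (WithLp.toLp 2 (w, f w)) = 0 := by simp [P]
    rw [hP0, accPt_principal_iff_nhdsWithin]
    simp
  have h3 := tangentConeAt_subset_zero hnacc h2
  have h4 : fderiv ℝ f w u.fst - u.snd = 0 := h3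
  rw [WithLp.prod_inner_apply]
  simp
  linarith

theorem toLp_mem_normalSpace_of_mem_clarkeSubdiff {f : V → ℝ} (hf : Continuous f)
    {𝒮 : Set (Set (WithLp 2 (V × ℝ)))}
    (h𝒮 : IsWhitneyC1Stratification 𝒮 (range fun w : V => WithLp.toLp 2 (w, f w)))
    {M : Set (WithLp 2 (V × ℝ))} (hM : M ∈ 𝒮) {w l : V} (hw : WithLp.toLp 2 (w, f w) ∈ M)
    (hl : l ∈ clarkeSubdiff f w) :
    WithLp.toLp 2 (l, (-1 : ℝ)) ∈ normalSpace M (WithLp.toLp 2 (w, f w)) := by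
  have hconv : Convex ℝ {l : V | WithLp.toLp 2 (l, (-1 : ℝ)) ∈
      normalSpace M (WithLp.toLp 2 (w, f w))} := by
    intro v hv u hu a b ha hb hab
    have := convex_normalSpace M _ hv hu ha hb hab
    have he : a • WithLp.toLp 2 (v, (-1 : ℝ)) + b • WithLp.toLp 2 (u, (-1 : ℝ)) =
        WithLp.toLp 2 (a • v + b • u, (-1 : ℝ)) := by
      rw [← WithLp.toLp_smul, ← WithLp.toLp_smul, ← WithLp.toLp_add]
      congr 1
      ext
      · simp
      · simp; linarith
    rwa [he] at this
  refine clarkeSubdiff_subset_of_convex hconv ?_ hl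
  rintro l ⟨s, hs, hd, hl⟩
  have hex : ∀ k, ∃ M' ∈ 𝒮, WithLp.toLp 2 (s k, f (s k)) ∈ M' := fun k => by
    have : WithLp.toLp 2 (s k, f (s k)) ∈ ⋃₀ 𝒮 := h𝒮.cover ▸ mem_range_self (s k)
    simpa using this
  choose M' hM' hsM' using hex
  -- There are finitely many strata, so one of them contains infinitely many of the points;
  -- Whitney's condition (a) is applied along that subsequence.
  have hfreq : ∃ M₂ ∈ 𝒮, ∃ᶠ k in atTop, M' k = M₂ := by
    by_contra! hcon
    have h1 : ∀ᶠ k in atTop, ∀ M₂ ∈ 𝒮, ¬ M' k = M₂ :=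
      (eventually_all_finite h𝒮.finite).2 fun M₂ h => hcon M₂ h
    obtain ⟨k, hk⟩ := h1.exists
    exact hk _ (hM' k) rfl
  obtain ⟨M₂, hM₂, hfreq⟩ := hfreq
  obtain ⟨ψ, hψ, hψM⟩ := extraction_of_frequently_atTop hfreq
  have hto : Continuous (fun p : V × ℝ => WithLp.toLp 2 p) := WithLp.prod_continuous_toLp 2 V ℝ
  refine h𝒮.whitney_a M hM M₂ hM₂ (fun k => WithLp.toLp 2 (s (ψ k), f (s (ψ k))))
    (fun k => WithLp.toLp 2 (gradient f (s (ψ k)), (-1 : ℝ))) _ _ (fun k => ?_) hw ?_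
    (fun k => ?_) ?_
  · rw [← hψM k]; exact hsM' _
  · have h1 := hs.comp hψ.tendsto_atTop
    exact (hto.tendsto _).comp (h1.prodMk_nhds ((hf.tendsto w).comp h1))
  · refine toLp_gradient_mem_normalSpace (hd _) ?_
    rw [← h𝒮.cover]
    exact subset_sUnion_of_mem hM₂
  · exact (hto.tendsto _).comp ((hl.comp hψ.tendsto_atTop).prodMk_nhds tendsto_const_nhds)

/-- The chain rule along arcs for Clarke subgradients of Whitney stratifiable functions. -/
theorem IsArc.ae_hasDerivAt_of_whitney {θ : ℝ → V} (hθ : IsArc θ) {f : V → ℝ}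
    (hf : LocallyLipschitz f) (hW : IsWhitneyC1Stratifiable f) :
    ∀ᵐ t, 0 ≤ t → ∀ v, HasDerivAt θ v t → ∀ l ∈ clarkeSubdiff f (θ t),
      HasDerivAt (fun s => f (θ s)) (inner ℝ l v) t := by
  obtain ⟨𝒮, h𝒮⟩ := hW
  let Γ : ℝ → WithLp 2 (V × ℝ) := fun t => WithLp.toLp 2 (θ t, f (θ t))
  have hacc : ∀ᵐ t, ∀ M ∈ 𝒮, Γ t ∈ M → AccPt t (𝓟 (Γ ⁻¹' M)) := by
    rw [ae_ball_iff h𝒮.finite.countable]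
    intro M _
    have h0 : volume {t ∈ Γ ⁻¹' M | ¬AccPt t (𝓟 (Γ ⁻¹' M))} = 0 :=
      (countable_not_accPt (Γ ⁻¹' M)).measure_zero _
    filter_upwards [compl_mem_ae_iff.2 h0] with t ht htM
    by_contra hcon
    exact ht ⟨htM, hcon⟩
  filter_upwards [hacc, hθ.ae_differentiableAt_comp hf] with t hacc hd h0 v hv l hl
  have hΓ : HasDerivAt Γ (WithLp.toLp 2 (v, deriv (fun s => f (θ s)) t)) t := by
    have h1 : HasDerivAt (fun s => (θ s, f (θ s))) (v, deriv (fun s => f (θ s)) t) t :=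
      hv.prodMk (hd h0).hasDerivAt
    exact ((WithLp.prodContinuousLinearEquiv 2 ℝ V ℝ).symm.hasFDerivAt).comp_hasDerivAt t h1
  have hcov : Γ t ∈ ⋃₀ 𝒮 := h𝒮.cover ▸ mem_range_self (θ t)
  obtain ⟨M, hM, htM⟩ := mem_sUnion.1 hcov
  have hn := toLp_mem_normalSpace_of_mem_clarkeSubdiff hf.continuous h𝒮 hM htM hl
  -- At an accumulation point the tangent cone of a subset of ℝ is all of ℝ, so the velocity of `Γ`
  -- lies in the tangent cone of the stratum. Orthogonality of (l, -1) to this velocity is the chain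
  -- rule.
  have h1 : (1 : ℝ) ∈ tangentConeAt ℝ (Γ ⁻¹' M) t := by
    rw [tangentConeAt_eq_univ (hacc M hM htM)]; trivial
  have h2 := hΓ.hasFDerivAt.hasFDerivWithinAt.mapsTo_tangent_cone h1
  have h3 := hn _ (tangentConeAt_mono (image_preimage_subset Γ M) h2)
  simp [WithLp.prod_inner_apply] at h3
  have h4 : inner ℝ l v = deriv (fun s => f (θ s)) t := by linarith
  rw [h4]
  exact (hd h0).hasDerivAt

theorem IsArc.ae_hasDerivAt_of_contDiff {θ : ℝ → V} {f : V → ℝ} (hf : ContDiff ℝ 1 f) :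
    ∀ᵐ t : ℝ, 0 ≤ t → ∀ v, HasDerivAt θ v t → ∀ l ∈ clarkeSubdiff f (θ t),
      HasDerivAt (fun s => f (θ s)) (inner ℝ l v) t := by
  refine Eventually.of_forall fun t _ v hv l hl => ?_
  rw [mem_singleton_iff.1 (clarkeSubdiff_subset_singleton hf _ hl)]
  exact hasDerivAt_inner_gradient (hf.differentiable one_ne_zero _) hv

end ChainRule

/-! ### Exponential averages of slowly varying functions -/

section Momentum

variable {V : Type*} [NormedAddCommGroup V] [InnerProductSpace ℝ V] [CompleteSpace V]

theorem hasDerivAt_exp_mul_sub (a t s : ℝ) :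
    HasDerivAt (fun s => Real.exp (-a * (t - s))) (a * Real.exp (-a * (t - s))) s := by
  have h1 : HasDerivAt (fun s : ℝ => -a * (t - s)) a s := by
    simpa using ((hasDerivAt_id s).const_sub t).const_mul (-a)
  simpa [mul_comm] using h1.exp

omit [CompleteSpace V] in
theorem intervalIntegrable_momentum_kernel {c : ℝ} {g : ℝ → V}
    {a b t : ℝ} (hg : IntervalIntegrable g volume a b) :
    IntervalIntegrable (fun s => (c * Real.exp (-c * (t - s))) • g s) volume a b :=
  hg.continuousOn_smul (by fun_prop)

theorem integral_momentum_kernel (c T t : ℝ) :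
    ∫ s in T..t, c * Real.exp (-c * (t - s)) = 1 - Real.exp (-c * (t - T)) := by
  rw [intervalIntegral.integral_eq_sub_of_hasDerivAt (fun s _ => hasDerivAt_exp_mul_sub c t s)
    (Continuous.intervalIntegrable (by fun_prop) _ _)]
  simp

/-- The memory of times before T fades by e^{-c(t-T)}, and the kernel has mass 1 - e^{-c(t-T)} on
[T, t], so a constant `A` can be subtracted from both parts. -/
theorem momentum_sub_eq {c : ℝ} {g : ℝ → V}
    (hg : ∀ t, 0 ≤ t → IntervalIntegrable g volume 0 t) {T t : ℝ} (hT : 0 ≤ T) (ht : T ≤ t)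
    (A : V) : momentum c g t - A = Real.exp (-c * (t - T)) • (momentum c g T - A) +
      ∫ s in T..t, (c * Real.exp (-c * (t - s))) • (g s - A) := by
  have hgT := hg T hT
  have hgt : IntervalIntegrable g volume T t := hgT.symm.trans (hg t (hT.trans ht))
  have h1 : momentum c g t = (∫ s in (0 : ℝ)..T, (c * Real.exp (-c * (t - s))) • g s) +
      ∫ s in T..t, (c * Real.exp (-c * (t - s))) • g s :=
    (intervalIntegral.integral_add_adjacent_intervals (intervalIntegrable_momentum_kernel hgT)
      (intervalIntegrable_momentum_kernel hgt)).symm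
  have h2 : (∫ s in (0 : ℝ)..T, (c * Real.exp (-c * (t - s))) • g s) =
      Real.exp (-c * (t - T)) • momentum c g T := by
    rw [momentum, ← intervalIntegral.integral_smul]
    congr 1
    funext s
    rw [smul_smul]
    congr 1
    rw [mul_left_comm, ← Real.exp_add]
    ring_nf
  have h3 : (∫ s in T..t, (c * Real.exp (-c * (t - s))) • (g s - A)) =
      (∫ s in T..t, (c * Real.exp (-c * (t - s))) • g s) - (1 - Real.exp (-c * (t - T))) • A := by
    simp only [smul_sub]
    rw [intervalIntegral.integral_sub (intervalIntegrable_momentum_kernel hgt)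
      (Continuous.intervalIntegrable (by fun_prop) _ _), intervalIntegral.integral_smul_const,
      integral_momentum_kernel]
  rw [h1, h2, h3, sub_smul, one_smul, smul_sub]
  abel

/-- Growth e^{δ(t-s)} into the past, with δ < c, costs only the factor c/(c-δ) against the kernel.
The negative term -b is kept because it must cancel the leading part of a when δ is small. -/
theorem norm_momentum_sub_le {c : ℝ} {g : ℝ → V} (hc : 0 < c)
    (hg : ∀ t, 0 ≤ t → IntervalIntegrable g volume 0 t) {T t : ℝ} (hT : 0 ≤ T) (ht : T ≤ t)
    {A : V} {δ a b : ℝ} (hδ : δ < c) (ha : 0 ≤ a)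
    (h : ∀ s ∈ Icc T t, ‖g s - A‖ ≤ a * Real.exp (δ * (t - s)) - b) :
    ‖momentum c g t - A‖ ≤ Real.exp (-c * (t - T)) * (‖momentum c g T‖ + ‖A‖) +
      a * (c / (c - δ)) - b * (1 - Real.exp (-c * (t - T))) := by
  have hint : ‖∫ s in T..t, (c * Real.exp (-c * (t - s))) • (g s - A)‖ ≤
      ∫ s in T..t, (a * (c / (c - δ)) * ((c - δ) * Real.exp (-(c - δ) * (t - s))) -
        b * (c * Real.exp (-c * (t - s)))) := by
    refine intervalIntegral.norm_integral_le_of_norm_le ht (Eventually.of_forall fun s hs => ?_)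
      (Continuous.intervalIntegrable (by fun_prop) _ _)
    have h1 := h s ⟨hs.1.le, hs.2⟩
    have hcδ : c - δ ≠ 0 := (sub_pos.2 hδ).ne'
    rw [norm_smul, Real.norm_of_nonneg (by positivity)]
    calc c * Real.exp (-c * (t - s)) * ‖g s - A‖
        ≤ c * Real.exp (-c * (t - s)) * (a * Real.exp (δ * (t - s)) - b) := by gcongr
      _ = _ := by
        have : Real.exp (-(c - δ) * (t - s)) =
            Real.exp (-c * (t - s)) * Real.exp (δ * (t - s)) := by
          rw [← Real.exp_add]; ring_nf
        rw [this]
        field_simp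
  have hval : (∫ s in T..t, (a * (c / (c - δ)) * ((c - δ) * Real.exp (-(c - δ) * (t - s))) -
        b * (c * Real.exp (-c * (t - s))))) =
      a * (c / (c - δ)) * (1 - Real.exp (-(c - δ) * (t - T))) -
        b * (1 - Real.exp (-c * (t - T))) := by
    rw [intervalIntegral.integral_sub (Continuous.intervalIntegrable (by fun_prop) _ _)
      (Continuous.intervalIntegrable (by fun_prop) _ _),
      intervalIntegral.integral_const_mul (a * (c / (c - δ))),
      intervalIntegral.integral_const_mul b, integral_momentum_kernel, integral_momentum_kernel]
  have hle : a * (c / (c - δ)) * (1 - Real.exp (-(c - δ) * (t - T))) ≤ a * (c / (c - δ)) := by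
    have : 0 < c - δ := sub_pos.2 hδ
    refine mul_le_of_le_one_right (by positivity) ?_
    linarith [Real.exp_pos (-(c - δ) * (t - T))]
  rw [momentum_sub_eq hg hT ht A]
  refine (norm_add_le _ _).trans ?_
  rw [norm_smul, Real.norm_of_nonneg (Real.exp_pos _).le]
  have h5 : Real.exp (-c * (t - T)) * ‖momentum c g T - A‖ ≤
      Real.exp (-c * (t - T)) * (‖momentum c g T‖ + ‖A‖) := by
    gcongr; exact norm_sub_le _ _
  linarith

/-- If `g` is asymptotic to a subexponentially varying `A` (both measured relative to `Q`), then
the momentum of `g` is asymptotic to `A`. -/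
theorem eventually_norm_momentum_sub_le {c : ℝ} {g A : ℝ → V} {Q : ℝ → ℝ} {C : ℝ} (hc : 0 < c)
    (hg : ∀ t, 0 ≤ t → IntervalIntegrable g volume 0 t) (hC : 0 ≤ C)
    (hQ : ∀ᶠ t in atTop, 0 < Q t) (hA : ∀ᶠ t in atTop, ‖A t‖ ≤ C * Q t)
    (hvar : ∀ δ, 0 < δ → ∃ T, ∀ s t, T ≤ s → s ≤ t → Q s ≤ Real.exp (δ * (t - s)) * Q t ∧
      ‖A s - A t‖ ≤ C * (Real.exp (δ * (t - s)) - 1) * Q t)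
    (hgA : ∀ ε, 0 < ε → ∀ᶠ t in atTop, ‖g t - A t‖ ≤ ε * Q t) {ε : ℝ} (hε : 0 < ε) :
    ∀ᶠ t in atTop, ‖momentum c g t - A t‖ ≤ ε * Q t := by
  -- The error that persists as t → ∞, in units of Q(t), is (C + δ)c/(c - δ) - C, which vanishes
  -- with δ.
  obtain ⟨δ, hδ0, hδc, hδε⟩ : ∃ δ, 0 < δ ∧ δ < c ∧ (C + δ) * (c / (c - δ)) - C < ε / 2 := by
    have hcont : ContinuousAt (fun δ : ℝ => (C + δ) * (c / (c - δ)) - C) 0 := by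
      have : c - 0 ≠ 0 := by simpa using hc.ne'
      fun_prop (disch := assumption)
    have h1 : ∀ᶠ δ in 𝓝 (0 : ℝ), (C + δ) * (c / (c - δ)) - C < ε / 2 := by
      refine hcont.eventually_lt continuousAt_const ?_
      simp [hc.ne']; linarith
    have h2 : ∀ᶠ δ in 𝓝[>] (0 : ℝ), 0 < δ ∧ δ < c ∧ (C + δ) * (c / (c - δ)) - C < ε / 2 := by
      filter_upwards [self_mem_nhdsWithin, nhdsWithin_le_nhds h1,
        nhdsWithin_le_nhds (gt_mem_nhds hc)] with δ h3 h4 h5 using ⟨h3, h5, h4⟩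
    exact h2.exists
  obtain ⟨T₁, hT₁⟩ := hvar δ hδ0
  obtain ⟨T₂, hT₂⟩ := eventually_atTop.1 ((hQ.and hA).and (hgA δ hδ0))
  set T := max (max T₁ T₂) 0 with hTdef
  have hTT₁ : T₁ ≤ T := (le_max_left _ _).trans (le_max_left _ _)
  have hTT₂ : T₂ ≤ T := (le_max_right _ _).trans (le_max_left _ _)
  have hT0 : 0 ≤ T := le_max_right _ _
  have hQT := (hT₂ T hTT₂).1.1
  -- The transient, in units of Q(t). Since Q(T) ≤ e^{δ(t-T)} Q(t), the old momentum still decays at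
  -- rate c - δ. One C comes from `A t`, the other from the missing mass of the kernel.
  have hlim : Tendsto (fun t => ‖momentum c g T‖ / Q T * Real.exp (-(c - δ) * (t - T)) +
      2 * C * Real.exp (-c * (t - T))) atTop (𝓝 0) := by
    have hexp : ∀ a : ℝ, 0 < a → Tendsto (fun t => Real.exp (-a * (t - T))) atTop (𝓝 0) := by
      intro a ha
      refine Real.tendsto_exp_atBot.comp ?_
      exact (tendsto_atTop_add_const_right _ (-T) tendsto_id).const_mul_atTop_of_neg (by linarith)
    simpa using ((hexp _ (sub_pos.2 hδc)).const_mul (‖momentum c g T‖ / Q T)).add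
      ((hexp c hc).const_mul (2 * C))
  filter_upwards [eventually_ge_atTop T, hlim.eventually (gt_mem_nhds (half_pos hε))] with t ht hsm
  obtain ⟨⟨hQt, hAt⟩, -⟩ := hT₂ t (hTT₂.trans ht)
  have hb : ∀ s ∈ Icc T t, ‖g s - A t‖ ≤
      (C + δ) * Q t * Real.exp (δ * (t - s)) - C * Q t := by
    intro s hs
    have h1 := (hT₂ s (hTT₂.trans hs.1)).2
    obtain ⟨h2, h3⟩ := hT₁ s t (hTT₁.trans hs.1) hs.2
    have h4 : ‖g s - A t‖ ≤ ‖g s - A s‖ + ‖A s - A t‖ := norm_sub_le_norm_sub_add_norm_sub _ _ _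
    have h5 : δ * Q s ≤ δ * (Real.exp (δ * (t - s)) * Q t) := by gcongr
    linarith
  have h6 := norm_momentum_sub_le hc hg hT0 ht hδc (by positivity) hb
  have h7 : Real.exp (-c * (t - T)) * ‖momentum c g T‖ ≤
      ‖momentum c g T‖ / Q T * Real.exp (-(c - δ) * (t - T)) * Q t := by
    have h8 := (hT₁ T t hTT₁ ht).1
    have h9 : Real.exp (-(c - δ) * (t - T)) =
        Real.exp (-c * (t - T)) * Real.exp (δ * (t - T)) := by
      rw [← Real.exp_add]; ring_nf
    calc Real.exp (-c * (t - T)) * ‖momentum c g T‖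
        = ‖momentum c g T‖ / Q T * Real.exp (-c * (t - T)) * Q T := by field_simp
      _ ≤ ‖momentum c g T‖ / Q T * Real.exp (-c * (t - T)) * (Real.exp (δ * (t - T)) * Q t) := by
        gcongr
      _ = _ := by rw [h9]; ring
  have h8 : Real.exp (-c * (t - T)) * ‖A t‖ ≤ Real.exp (-c * (t - T)) * (C * Q t) := by gcongr
  have h9 := mul_lt_mul_of_pos_right hsm hQt
  have h10 := mul_lt_mul_of_pos_right hδε hQt
  linarith

end Momentum

/-! ### The exponent of the loss -/

section LossExponent

variable {φ : ℝ → ℝ}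

theorem IsLossExponent.differentiable (hφ : IsLossExponent φ) : Differentiable ℝ φ :=
  hφ.1.differentiable two_ne_zero

theorem IsLossExponent.differentiable_deriv (hφ : IsLossExponent φ) :
    Differentiable ℝ (deriv φ) := by
  have : ContDiff ℝ (1 + 1) φ := by simpa [one_add_one_eq_two] using hφ.1
  exact (contDiff_succ_iff_deriv.1 this).2.2.differentiable one_ne_zero

theorem IsLossExponent.deriv_pos (hφ : IsLossExponent φ) (z : ℝ) : 0 < deriv φ z :=
  let ⟨_, h⟩ := hφ.2.1
  (h z).1

theorem IsLossExponent.monotone_deriv (hφ : IsLossExponent φ) : Monotone (deriv φ) :=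
  let ⟨_, h⟩ := hφ.2.2
  monotone_of_deriv_nonneg hφ.differentiable_deriv fun z => (h z).1

/-- The derivative of a loss exponent increases to a positive limit. -/
theorem IsLossExponent.exists_limit (hφ : IsLossExponent φ) :
    ∃ β, 0 < β ∧ Tendsto (deriv φ) atTop (𝓝 β) ∧ ∀ z, deriv φ z ≤ β := by
  obtain ⟨B, hB⟩ := hφ.2.1
  have hbdd : BddAbove (range (deriv φ)) := ⟨B, by rintro _ ⟨z, rfl⟩; exact (hB z).2⟩
  exact ⟨⨆ z, deriv φ z, (hφ.deriv_pos 0).trans_le (le_ciSup hbdd 0),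
    tendsto_atTop_ciSup hφ.monotone_deriv hbdd, le_ciSup hbdd⟩

theorem abs_sub_le_of_deriv_le {u : ℝ → ℝ} (hu : Differentiable ℝ u) {B : ℝ}
    (hB : ∀ z, |deriv u z| ≤ B) (a b : ℝ) : |u a - u b| ≤ B * |a - b| := by
  simpa only [Real.norm_eq_abs] using convex_univ.norm_image_sub_le_of_norm_deriv_le
    (fun z _ => hu z) (fun z _ => hB z) (mem_univ b) (mem_univ a)

theorem IsLossExponent.exists_abs_sub_le (hφ : IsLossExponent φ) :
    ∃ B, 0 ≤ B ∧ (∀ a b, |φ a - φ b| ≤ B * |a - b|) ∧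
      ∀ a b, |deriv φ a - deriv φ b| ≤ B * |a - b| := by
  obtain ⟨B₁, h₁⟩ := hφ.2.1
  obtain ⟨B₂, h₂⟩ := hφ.2.2
  have hB₁ : 0 ≤ B₁ := (h₁ 0).1.le.trans (h₁ 0).2
  refine ⟨max B₁ B₂, hB₁.trans (le_max_left _ _), abs_sub_le_of_deriv_le hφ.differentiable
    fun z => ?_, abs_sub_le_of_deriv_le hφ.differentiable_deriv fun z => ?_⟩
  · rw [abs_of_pos (h₁ z).1]; exact (h₁ z).2.trans (le_max_left _ _)
  · rw [abs_of_nonneg (h₂ z).1]; exact (h₂ z).2.trans (le_max_right _ _)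

theorem abs_log_sub_log_le {a x y : ℝ} (ha : 0 < a) (hx : a ≤ x) (hy : a ≤ y) :
    |Real.log x - Real.log y| ≤ a⁻¹ * |x - y| := by
  have key : ∀ {x y : ℝ}, a ≤ x → a ≤ y → Real.log x - Real.log y ≤ a⁻¹ * |x - y| := by
    intro x y hx hy
    have hx0 := ha.trans_le hx
    have hy0 := ha.trans_le hy
    rw [← Real.log_div hx0.ne' hy0.ne']
    calc Real.log (x / y) ≤ x / y - 1 := Real.log_le_sub_one_of_pos (by positivity)
      _ = y⁻¹ * (x - y) := by field_simp
      _ ≤ y⁻¹ * |x - y| := by gcongr; exact le_abs_self _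
      _ ≤ a⁻¹ * |x - y| := by gcongr
  rw [abs_le]
  constructor
  · have := key hy hx
    rw [abs_sub_comm] at this
    linarith
  · exact key hx hy

end LossExponent

/-! ### Slow variation along the trajectory and asymptotics of the momentum -/

section DirectionalTrajectory

variable {V : Type*} [NormedAddCommGroup V] [InnerProductSpace ℝ V]
  {m : ℕ}

/-- A trajectory of normalized momentum steepest descent on the homogeneous margin functions `F i`,
with subgradients `k i t` that satisfy the chain rule and converge after normalization. -/
structure IsDirectionalTrajectory (N : V → ℝ) (φ : ℝ → ℝ) (F : Fin m → V → ℝ) (L c : ℝ)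
    (η : ℝ → ℝ) (θ g : ℝ → V) (k : Fin m → ℝ → V) (kbar : Fin m → V) (θbar : V) : Prop where
  isNorm : IsNorm N
  exponent : IsLossExponent φ
  one_le : 1 ≤ L
  lip : ∀ i, LocallyLipschitz (F i)
  hom : ∀ i (w : V) (a : ℝ), 0 < a → F i (a • w) = a ^ L * F i w
  c_pos : 0 < c
  η_pos : ∀ t, 0 < t → 0 < η t
  arc : IsArc θ
  integrable : ∀ t, 0 ≤ t → IntervalIntegrable g volume 0 t
  g_eq : ∀ t, 0 ≤ t →
    g t = -∑ i, (Real.exp (-φ (F i (θ t))) * deriv φ (F i (θ t))) • k i t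
  chain : ∀ᵐ t, 0 ≤ t → ∀ v, HasDerivAt θ v t → ∀ i,
    HasDerivAt (fun s => F i (θ s)) (inner ℝ (k i t) v) t
  update : ∀ᵐ t, 0 ≤ t → ∃ v ∈ steepestDirections N (momentum c g t), HasDerivAt θ (η t • v) t
  k_lim : ∀ i, Tendsto (fun t => (N (θ t) ^ (L - 1))⁻¹ • k i t) atTop (𝓝 (kbar i))
  schedule : ScheduleCondition η L
  nontrivial : IsNontrivial N θ
  direction : Tendsto (fun t => (N (θ t))⁻¹ • θ t) atTop (𝓝 θbar)
  margin_pos : ∀ i, 0 < F i θbar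
  euler : ∀ i, inner ℝ (kbar i) θbar = L * F i θbar

namespace IsDirectionalTrajectory

variable {N : V → ℝ} {φ : ℝ → ℝ} {F : Fin m → V → ℝ} {L c : ℝ} {η : ℝ → ℝ} {θ g : ℝ → V}
  {k : Fin m → ℝ → V} {kbar : Fin m → V} {θbar : V}
  (h : IsDirectionalTrajectory N φ F L c η θ g k kbar θbar)
include h

theorem exists_lower : ∃ a, 0 < a ∧ ∀ᶠ t in atTop, a ≤ N (θ t) := by
  obtain ⟨a, ha, t₀, -, ht⟩ := h.nontrivial
  exact ⟨a, ha, eventually_atTop.2 ⟨t₀, ht⟩⟩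

theorem eventually_norm_pos : ∀ᶠ t in atTop, 0 < N (θ t) := by
  obtain ⟨a, ha, ht⟩ := h.exists_lower
  exact ht.mono fun t h => ha.trans_le h

theorem tendsto_margin (i : Fin m) :
    Tendsto (fun t => F i ((N (θ t))⁻¹ • θ t)) atTop (𝓝 (F i θbar)) :=
  ((h.lip i).continuous.tendsto _).comp h.direction

theorem eventually_eq_rpow_mul : ∀ᶠ t in atTop, ∀ i,
    F i (θ t) = N (θ t) ^ L * F i ((N (θ t))⁻¹ • θ t) := by
  filter_upwards [h.eventually_norm_pos] with t ht i
  rw [← h.hom i _ _ ht, smul_smul, mul_inv_cancel₀ ht.ne', one_smul]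

theorem eventually_margin_pos : ∀ᶠ t in atTop, ∀ i, 0 < F i (θ t) := by
  have h1 : ∀ᶠ t in atTop, ∀ i, 0 < F i ((N (θ t))⁻¹ • θ t) :=
    eventually_all.2 fun i => (h.tendsto_margin i).eventually (lt_mem_nhds (h.margin_pos i))
  filter_upwards [h.eventually_norm_pos, h.eventually_eq_rpow_mul, h1] with t h0 h2 h1 i
  rw [h2]
  have := h1 i
  positivity

theorem ae_hasDerivAt : ∀ᵐ t, 0 < t → ∃ v, N v = 1 ∧
    (∀ w, N w = 1 → inner ℝ w (-momentum c g t) ≤ inner ℝ v (-momentum c g t)) ∧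
    HasDerivAt θ (η t • v) t ∧
    ∀ i, HasDerivAt (fun s => F i (θ s)) (η t * inner ℝ (k i t) v) t := by
  filter_upwards [h.update, h.chain] with t hu hc ht
  obtain ⟨v, hv, hd⟩ := hu ht.le
  refine ⟨v, hv.1, fun w hw => ?_, hd, fun i => ?_⟩
  · simpa [inner_neg_right] using hv.2 w hw
  · simpa [real_inner_smul_right] using hc ht.le _ hd i

theorem tendsto_schedule : Tendsto η atTop (𝓝 0) := by
  have hL0 : 0 < L := one_pos.trans_le h.one_le
  have h1 : (fun t : ℝ => t ^ (1 / L - 1)) =O[atTop] fun _ => (1 : ℝ) := by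
    refine Asymptotics.IsBigO.of_bound 1 ?_
    filter_upwards [eventually_ge_atTop 1] with t ht
    have h2 : 1 / L ≤ 1 := by rw [div_le_one hL0]; exact h.one_le
    rw [Real.norm_of_nonneg (by positivity), norm_one, mul_one]
    exact Real.rpow_le_one_of_one_le_of_nonpos ht (by linarith)
  exact (Asymptotics.isLittleO_one_iff ℝ).1 (h.schedule.2.trans_isBigO h1)

variable [FiniteDimensional ℝ V]

theorem locallyLipschitz_norm : LocallyLipschitz N :=
  h.isNorm.exists_lipschitzWith.choose_spec.locallyLipschitz

/-- Steepest directions have N-length 1, so θ has N-speed η; the reverse triangle inequality for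
difference quotients passes this bound on to N(θ). -/
theorem ae_abs_deriv_norm_le : ∀ᵐ t, 0 < t → |deriv (fun s => N (θ s)) t| ≤ η t := by
  filter_upwards [h.ae_hasDerivAt, h.arc.ae_differentiableAt_comp h.locallyLipschitz_norm]
    with t hv hd ht
  obtain ⟨v, hv1, -, hθ, -⟩ := hv ht
  have h1 := (hd ht.le).hasDerivAt.tendsto_slope
  have h2 := hθ.tendsto_slope
  have h3 : Tendsto (fun s => N (slope θ t s)) (𝓝[≠] t) (𝓝 (N (η t • v))) :=
    (h.isNorm.continuous.tendsto _).comp h2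
  rw [h.isNorm.smul_of_nonneg (h.η_pos t ht).le, hv1, mul_one] at h3
  refine le_of_tendsto_of_tendsto h1.abs h3 (Eventually.of_forall fun s => ?_)
  simp only [slope_def_field, slope_def_module, abs_div, h.isNorm.smul, abs_inv]
  rw [div_eq_inv_mul]
  gcongr
  exact h.isNorm.abs_sub_le _ _

/-- Integrate |dN/dt| ≤ η ≤ t^{1/L-1}, whose primitive is L t^{1/L}. -/
theorem exists_growth : ∃ C, 0 < C ∧ ∀ᶠ t in atTop, N (θ t) ≤ C * t ^ (1 / L) := by
  have hL0 : 0 < L := one_pos.trans_le h.one_le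
  obtain ⟨T₀, hT₀⟩ := eventually_atTop.1 (h.schedule.2.bound one_pos)
  set T := max T₀ 1 with hT
  have hT1 : 1 ≤ T := le_max_right _ _
  have hp := h.isNorm.nonneg (θ T)
  refine ⟨N (θ T) + L, by linarith, ?_⟩
  filter_upwards [eventually_ge_atTop T] with t ht
  have hac := h.arc.absolutelyContinuousOnInterval_comp h.locallyLipschitz_norm
    (zero_le_one.trans hT1) (zero_le_one.trans (hT1.trans ht))
  have hder : ∀ s, 0 < s → HasDerivAt (fun s : ℝ => L * s ^ (1 / L)) (s ^ (1 / L - 1)) s := by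
    intro s hs
    have := (Real.hasDerivAt_rpow_const (x := s) (p := 1 / L) (Or.inl hs.ne')).const_mul L
    rwa [← mul_assoc, mul_one_div_cancel hL0.ne', one_mul] at this
  have hac2 : AbsolutelyContinuousOnInterval (fun s : ℝ => L * s ^ (1 / L)) T t := by
    refine ContDiffOn.absolutelyContinuousOnInterval fun s hs => ?_
    rw [uIcc_of_le ht] at hs
    have hs0 : s ≠ 0 := by linarith [hs.1]
    exact (contDiffAt_const.mul (Real.contDiffAt_rpow_const_of_ne hs0)).contDiffWithinAt
  have hle := hac.sub_le_sub ht hac2 <| by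
    filter_upwards [h.ae_abs_deriv_norm_le] with s hs hsT
    have hs0 : 0 < s := by linarith [hsT.1]
    rw [(hder s hs0).deriv]
    refine (le_abs_self _).trans ((hs hs0).trans ?_)
    have := hT₀ s ((le_max_left _ _).trans hsT.1)
    rw [one_mul, Real.norm_of_nonneg (h.η_pos s hs0).le, Real.norm_of_nonneg (by positivity)] at this
    exact this
  have h1 : 1 ≤ t ^ (1 / L) := Real.one_le_rpow (hT1.trans ht) (by positivity)
  have h2 : 0 ≤ T ^ (1 / L) := by positivity
  nlinarith

/-- The growth bound gives N^{L-1} = O(t^{1-1/L}), the reciprocal of the power in the schedule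
condition; this is why that exponent appears. -/
theorem tendsto_rpow_mul_schedule : Tendsto (fun t => N (θ t) ^ (L - 1) * η t) atTop (𝓝 0) := by
  have hL0 : 0 < L := one_pos.trans_le h.one_le
  obtain ⟨C, hC, hgr⟩ := h.exists_growth
  have h1 : Tendsto (fun t => C ^ (L - 1) * (η t / t ^ (1 / L - 1))) atTop (𝓝 0) := by
    simpa using (h.schedule.2.tendsto_div_nhds_zero).const_mul (C ^ (L - 1))
  refine squeeze_zero' ?_ ?_ h1
  · filter_upwards [eventually_gt_atTop 0, h.eventually_norm_pos] with t ht hN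
    have := h.η_pos t ht
    positivity
  · filter_upwards [eventually_gt_atTop 0, h.eventually_norm_pos, hgr] with t ht hN hle
    have hη := h.η_pos t ht
    have h2 : N (θ t) ^ (L - 1) ≤ C ^ (L - 1) * (t ^ (1 / L - 1))⁻¹ := by
      calc N (θ t) ^ (L - 1) ≤ (C * t ^ (1 / L)) ^ (L - 1) := by
            gcongr; linarith [h.one_le]
        _ = C ^ (L - 1) * (t ^ (1 / L - 1))⁻¹ := by
            rw [Real.mul_rpow hC.le (by positivity), ← Real.rpow_mul ht.le, ← Real.rpow_neg ht.le]
            have he : 1 / L * (L - 1) = -(1 / L - 1) := by field_simp; ring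
            rw [he]
    calc N (θ t) ^ (L - 1) * η t ≤ C ^ (L - 1) * (t ^ (1 / L - 1))⁻¹ * η t := by gcongr
      _ = _ := by rw [div_eq_mul_inv]; ring

omit [FiniteDimensional ℝ V] in
theorem exists_norm_le : ∃ C, 0 < C ∧ ∀ᶠ t in atTop, ∀ i, ‖k i t‖ ≤ C * N (θ t) ^ (L - 1) := by
  have h0 : 0 ≤ ∑ i, ‖kbar i‖ := Finset.sum_nonneg fun i _ => norm_nonneg _
  refine ⟨∑ i, ‖kbar i‖ + 1, by linarith, ?_⟩
  have h1 : ∀ᶠ t in atTop, ∀ i, ‖(N (θ t) ^ (L - 1))⁻¹ • k i t‖ < ‖kbar i‖ + 1 :=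
    eventually_all.2 fun i => (h.k_lim i).norm.eventually (gt_mem_nhds (by linarith))
  filter_upwards [h1, h.eventually_norm_pos] with t ht hN i
  have h2 := ht i
  have hr : 0 < N (θ t) ^ (L - 1) := by positivity
  rw [norm_smul, norm_inv, Real.norm_of_nonneg hr.le, inv_mul_eq_div, div_lt_iff₀ hr] at h2
  have h3 : ‖kbar i‖ ≤ ∑ i, ‖kbar i‖ :=
    Finset.single_le_sum (f := fun i => ‖kbar i‖) (fun _ _ => norm_nonneg _) (Finset.mem_univ i)
  exact h2.le.trans (by gcongr)

omit h in
theorem _root_.AbsolutelyContinuousOnInterval.abs_sub_le {u : ℝ → ℝ} {a b δ : ℝ} (hab : a ≤ b)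
    (hu : AbsolutelyContinuousOnInterval u a b)
    (hd : ∀ᵐ t, t ∈ Icc a b → |deriv u t| ≤ δ) : |u b - u a| ≤ δ * (b - a) := by
  have hlin : ∀ δ : ℝ, AbsolutelyContinuousOnInterval (fun s : ℝ => δ * s) a b := fun δ =>
    ContDiffOn.absolutelyContinuousOnInterval (by fun_prop)
  have hder : ∀ δ t : ℝ, deriv (fun s : ℝ => δ * s) t = δ := fun δ t => by
    simp
  have h1 := hu.sub_le_sub hab (hlin δ) <| hd.mono fun t ht hm => by
    rw [hder]; exact (abs_le.1 (ht hm)).2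
  have h2 := (hlin (-δ)).sub_le_sub hab hu <| hd.mono fun t ht hm => by
    rw [hder]; exact (abs_le.1 (ht hm)).1
  rw [abs_le]
  constructor <;> linarith

/-- The margins have derivative η⟨k_i, v⟩ = O(N^{L-1} η), which tends to 0, and N has derivative at
most η, which tends to 0 too. -/
theorem slow_variation {δ : ℝ} (hδ : 0 < δ) : ∃ T, ∀ s t, T ≤ s → s ≤ t →
    |N (θ t) - N (θ s)| ≤ δ * (t - s) ∧ ∀ i, |F i (θ t) - F i (θ s)| ≤ δ * (t - s) := by
  obtain ⟨C, hC, hk⟩ := h.exists_norm_le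
  obtain ⟨D, hD, hDv⟩ := h.isNorm.exists_norm_le_mul
  have hη := h.tendsto_schedule.eventually (gt_mem_nhds hδ)
  have hη' := h.tendsto_rpow_mul_schedule.eventually
    (gt_mem_nhds (show 0 < δ / (C * D) by positivity))
  obtain ⟨T₀, hT₀⟩ := eventually_atTop.1 ((hk.and hη).and hη')
  refine ⟨max T₀ 1, fun s t hs hst => ?_⟩
  have hs0 : 1 ≤ s := (le_max_right _ _).trans hs
  have hsT : T₀ ≤ s := (le_max_left _ _).trans hs
  constructor
  · refine (h.arc.absolutelyContinuousOnInterval_comp h.locallyLipschitz_norm (by linarith)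
      (by linarith)).abs_sub_le hst ?_
    filter_upwards [h.ae_abs_deriv_norm_le] with x hx hm
    exact (hx (by linarith [hm.1])).trans (hT₀ x (hsT.trans hm.1)).1.2.le
  · intro i
    refine (h.arc.absolutelyContinuousOnInterval_comp (h.lip i) (by linarith)
      (by linarith)).abs_sub_le hst ?_
    filter_upwards [h.ae_hasDerivAt] with x hx hm
    have hx0 : 0 < x := by linarith [hm.1]
    obtain ⟨v, hv1, -, -, hd⟩ := hx hx0
    obtain ⟨⟨hk, -⟩, hη⟩ := hT₀ x (hsT.trans hm.1)
    have hv : ‖v‖ ≤ D := by simpa [hv1] using hDv v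
    have hηx := h.η_pos x hx0
    rw [(hd i).deriv, abs_mul, abs_of_pos hηx]
    calc η x * |inner ℝ (k i x) v| ≤ η x * (‖k i x‖ * ‖v‖) := by
          gcongr; exact abs_real_inner_le_norm _ _
      _ ≤ η x * (C * N (θ x) ^ (L - 1) * D) := by
          have := (norm_nonneg _).trans (hk i)
          gcongr; exact hk i
      _ = C * D * (N (θ x) ^ (L - 1) * η x) := by ring
      _ ≤ C * D * (δ / (C * D)) := by gcongr
      _ = δ := by field_simp

end IsDirectionalTrajectory

/-- The coefficient of the normalized subgradient of `F i` in the (negative) loss gradient. -/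
noncomputable def weight (N : V → ℝ) (φ : ℝ → ℝ) (F : Fin m → V → ℝ) (L : ℝ) (i : Fin m)
    (w : V) : ℝ :=
  Real.exp (-φ (F i w)) * deriv φ (F i w) * N w ^ (L - 1)

namespace IsDirectionalTrajectory

variable {N : V → ℝ} {φ : ℝ → ℝ} {F : Fin m → V → ℝ} {L c : ℝ} {η : ℝ → ℝ} {θ g : ℝ → V}
  {k : Fin m → ℝ → V} {kbar : Fin m → V} {θbar : V}
  (h : IsDirectionalTrajectory N φ F L c η θ g k kbar θbar)
include h

theorem weight_pos : ∀ᶠ t in atTop, ∀ i, 0 < weight N φ F L i (θ t) := by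
  filter_upwards [h.eventually_norm_pos] with t ht i
  have := h.exponent.deriv_pos (F i (θ t))
  unfold weight
  positivity

theorem sum_weight_pos [NeZero m] : ∀ᶠ t in atTop, 0 < ∑ i, weight N φ F L i (θ t) := by
  filter_upwards [h.weight_pos] with t ht
  exact Finset.sum_pos (fun i _ => ht i) ⟨0, Finset.mem_univ _⟩

variable [FiniteDimensional ℝ V]

/-- Where the margins are positive and N ≥ a, the logarithm of a weight is a Lipschitz function of
the margin and of N, so it inherits their slow variation. -/
theorem weight_le_exp_mul {δ : ℝ} (hδ : 0 < δ) : ∃ T, ∀ s t, T ≤ s → s ≤ t → ∀ i,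
    weight N φ F L i (θ s) ≤ Real.exp (δ * (t - s)) * weight N φ F L i (θ t) ∧
    weight N φ F L i (θ t) ≤ Real.exp (δ * (t - s)) * weight N φ F L i (θ s) := by
  obtain ⟨a, ha, hr⟩ := h.exists_lower
  obtain ⟨B, hB, hB₁, hB₂⟩ := h.exponent.exists_abs_sub_le
  set b := deriv φ 0 with hb
  have hb0 : 0 < b := h.exponent.deriv_pos 0
  have hL : 0 ≤ L - 1 := by linarith [h.one_le]
  -- The Lipschitz constants of φ, of log φ' (as φ' ≥ φ'(0) = b on positive margins) and of (L - 1)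
  -- log N.
  set C := B + b⁻¹ * B + a⁻¹ * (L - 1) with hC
  have hC0 : 0 ≤ C := by positivity
  obtain ⟨T₁, hT₁⟩ := h.slow_variation (δ := δ / (C + 1)) (by positivity)
  obtain ⟨T₂, hT₂⟩ := eventually_atTop.1 (hr.and h.eventually_margin_pos)
  refine ⟨max T₁ T₂, fun s t hs hst i => ?_⟩
  have hs1 := (le_max_left _ _).trans hs
  have hs2 := (le_max_right _ _).trans hs
  obtain ⟨hΔr, hΔz⟩ := hT₁ s t hs1 hst
  obtain ⟨hrs, hzs⟩ := hT₂ s hs2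
  obtain ⟨hrt, hzt⟩ := hT₂ t (hs2.trans hst)
  set ψ : ℝ → ℝ := fun t => -φ (F i (θ t)) + Real.log (deriv φ (F i (θ t))) +
    Real.log (N (θ t)) * (L - 1) with hψ
  have hw : ∀ t, 0 < N (θ t) → weight N φ F L i (θ t) = Real.exp (ψ t) := by
    intro t ht
    rw [hψ, weight, Real.exp_add, Real.exp_add, Real.exp_log (h.exponent.deriv_pos _),
      Real.rpow_def_of_pos ht]
  have h1 := hB₁ (F i (θ t)) (F i (θ s))
  have h2 := (abs_log_sub_log_le hb0 (h.exponent.monotone_deriv (hzt i).le)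
    (h.exponent.monotone_deriv (hzs i).le)).trans
    (mul_le_mul_of_nonneg_left (hB₂ (F i (θ t)) (F i (θ s))) (by positivity))
  have h3 := abs_log_sub_log_le ha hrt hrs
  have h4 : |ψ t - ψ s| ≤ δ * (t - s) := by
    have h5 : |ψ t - ψ s| ≤ |φ (F i (θ t)) - φ (F i (θ s))| +
        |Real.log (deriv φ (F i (θ t))) - Real.log (deriv φ (F i (θ s)))| +
        |Real.log (N (θ t)) - Real.log (N (θ s))| * (L - 1) := by
      have : ψ t - ψ s = -(φ (F i (θ t)) - φ (F i (θ s))) +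
        (Real.log (deriv φ (F i (θ t))) - Real.log (deriv φ (F i (θ s)))) +
        (Real.log (N (θ t)) - Real.log (N (θ s))) * (L - 1) := by rw [hψ]; ring
      rw [this]
      refine (abs_add_le _ _).trans (add_le_add ((abs_add_le _ _).trans ?_) ?_)
      · rw [abs_neg]
      · rw [abs_mul, abs_of_nonneg hL]
    calc |ψ t - ψ s| ≤ B * (δ / (C + 1) * (t - s)) + b⁻¹ * (B * (δ / (C + 1) * (t - s))) +
          a⁻¹ * (δ / (C + 1) * (t - s)) * (L - 1) := by
          refine h5.trans (add_le_add (add_le_add ?_ ?_) ?_)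
          · exact h1.trans (mul_le_mul_of_nonneg_left (hΔz i) hB)
          · refine h2.trans ?_
            have := hΔz i
            gcongr
          · refine mul_le_mul_of_nonneg_right (h3.trans ?_) hL
            gcongr
      _ = C / (C + 1) * (δ * (t - s)) := by rw [hC]; field_simp
      _ ≤ 1 * (δ * (t - s)) := by
          have : 0 ≤ t - s := by linarith
          gcongr
          rw [div_le_one (by linarith)]
          linarith
      _ = _ := one_mul _
  rw [hw s (ha.trans_le hrs), hw t (ha.trans_le hrt), ← Real.exp_add, ← Real.exp_add,
    Real.exp_le_exp, Real.exp_le_exp]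
  rw [abs_le] at h4
  constructor <;> linarith

omit [FiniteDimensional ℝ V] in
-- The factor N^{L-1} taken out of each subgradient is absorbed by its weight; what is left
-- converges, so freezing it at its limit costs o(1) per unit of weight.
theorem gradient_asymptotics {ε : ℝ} (hε : 0 < ε) : ∀ᶠ t in atTop,
    ‖g t - -∑ i, weight N φ F L i (θ t) • kbar i‖ ≤ ε * ∑ i, weight N φ F L i (θ t) := by
  have h1 : ∀ᶠ t in atTop, ∀ i, ‖(N (θ t) ^ (L - 1))⁻¹ • k i t - kbar i‖ < ε :=
    eventually_all.2 fun i => by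
      simpa [dist_eq_norm] using (h.k_lim i).eventually (Metric.ball_mem_nhds _ hε)
  filter_upwards [h1, h.weight_pos, h.eventually_norm_pos, eventually_ge_atTop 0]
    with t ht hw hN h0
  have hr : 0 < N (θ t) ^ (L - 1) := by positivity
  have heq : g t - -∑ i, weight N φ F L i (θ t) • kbar i =
      -∑ i, weight N φ F L i (θ t) • ((N (θ t) ^ (L - 1))⁻¹ • k i t - kbar i) := by
    rw [h.g_eq t h0]
    simp only [smul_sub, Finset.sum_sub_distrib, smul_smul]
    have : ∀ i, weight N φ F L i (θ t) * (N (θ t) ^ (L - 1))⁻¹ =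
        Real.exp (-φ (F i (θ t))) * deriv φ (F i (θ t)) := fun i => by
      rw [weight, mul_assoc, mul_inv_cancel₀ hr.ne', mul_one]
    simp only [this]
    abel
  rw [heq, norm_neg, Finset.mul_sum]
  refine (norm_sum_le _ _).trans (Finset.sum_le_sum fun i _ => ?_)
  rw [norm_smul, Real.norm_of_nonneg (hw i).le, mul_comm]
  exact mul_le_mul_of_nonneg_right (ht i).le (hw i).le

/-- The momentum is asymptotic to the loss gradient with frozen subgradients. -/
theorem momentum_asymptotics [NeZero m] {ε : ℝ} (hε : 0 < ε) : ∀ᶠ t in atTop,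
    ‖momentum c g t - -∑ i, weight N φ F L i (θ t) • kbar i‖ ≤
      ε * ∑ i, weight N φ F L i (θ t) := by
  have hk : ∀ i, ‖kbar i‖ ≤ ∑ i, ‖kbar i‖ := fun i =>
    Finset.single_le_sum (f := fun i => ‖kbar i‖) (fun _ _ => norm_nonneg _) (Finset.mem_univ i)
  refine eventually_norm_momentum_sub_le (C := ∑ i, ‖kbar i‖) h.c_pos h.integrable
    (Finset.sum_nonneg fun i _ => norm_nonneg _) h.sum_weight_pos ?_ ?_
    (fun ε hε => h.gradient_asymptotics hε) hε
  · filter_upwards [h.weight_pos] with t hw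
    rw [norm_neg, Finset.mul_sum]
    refine (norm_sum_le _ _).trans (Finset.sum_le_sum fun i _ => ?_)
    rw [norm_smul, Real.norm_of_nonneg (hw i).le, mul_comm]
    exact mul_le_mul_of_nonneg_right (hk i) (hw i).le
  · intro δ hδ
    obtain ⟨T₁, hT₁⟩ := h.weight_le_exp_mul hδ
    obtain ⟨T₂, hT₂⟩ := eventually_atTop.1 h.weight_pos
    refine ⟨max T₁ T₂, fun s t hs hst => ?_⟩
    have hs1 := (le_max_left _ _).trans hs
    have hs2 := (le_max_right _ _).trans hs
    have hw := hT₁ s t hs1 hst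
    have hwt := hT₂ t (hs2.trans hst)
    constructor
    · rw [Finset.mul_sum]
      exact Finset.sum_le_sum fun i _ => (hw i).1
    · have heq : -∑ i, weight N φ F L i (θ s) • kbar i - -∑ i, weight N φ F L i (θ t) • kbar i =
          ∑ i, (weight N φ F L i (θ t) - weight N φ F L i (θ s)) • kbar i := by
        simp only [sub_smul, Finset.sum_sub_distrib]
        abel
      rw [heq, Finset.mul_sum]
      refine (norm_sum_le _ _).trans (Finset.sum_le_sum fun i _ => ?_)
      obtain ⟨h1, h2⟩ := hw i
      have hE : 1 ≤ Real.exp (δ * (t - s)) :=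
        Real.one_le_exp (mul_nonneg hδ.le (by linarith))
      have habs : |weight N φ F L i (θ t) - weight N φ F L i (θ s)| ≤
          (Real.exp (δ * (t - s)) - 1) * weight N φ F L i (θ t) := by
        have := hwt i
        rw [abs_le]
        constructor
        · linarith
        · have h3 : weight N φ F L i (θ t) * (Real.exp (δ * (t - s)))⁻¹ ≤
              weight N φ F L i (θ s) := by
            rw [← div_eq_mul_inv, div_le_iff₀ (by positivity)]
            linarith
          -- This is E + E⁻¹ ≥ 2.
          have h4 : 1 - (Real.exp (δ * (t - s)))⁻¹ ≤ Real.exp (δ * (t - s)) - 1 := by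
            have h5 : 0 < Real.exp (δ * (t - s)) := by positivity
            have h6 : Real.exp (δ * (t - s)) * (Real.exp (δ * (t - s)))⁻¹ = 1 :=
              mul_inv_cancel₀ h5.ne'
            nlinarith [inv_pos.2 h5]
          nlinarith
      rw [norm_smul, Real.norm_eq_abs]
      calc _ ≤ (Real.exp (δ * (t - s)) - 1) * weight N φ F L i (θ t) * ∑ i, ‖kbar i‖ := by
            refine mul_le_mul habs (hk i) (norm_nonneg _) (mul_nonneg ?_ (hwt i).le)
            linarith
        _ = _ := by ring

end IsDirectionalTrajectory

end DirectionalTrajectory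

/-! ### The logarithm of the loss -/

section LogLoss

variable {V : Type*} [NormedAddCommGroup V] [InnerProductSpace ℝ V] {m : ℕ}

theorem _root_.LocallyLipschitz.pi {E ι : Type*} [PseudoEMetricSpace E] [Fintype ι]
    {F : ι → E → ℝ} (hF : ∀ i, LocallyLipschitz (F i)) :
    LocallyLipschitz fun w i => F i w := by
  intro w
  choose K U hU hK using fun i => hF i w
  refine ⟨∑ i, K i, ⋂ i, U i, Filter.iInter_mem.2 hU, fun a ha b hb => ?_⟩
  rw [edist_pi_le_iff]
  intro i
  refine (hK i (mem_iInter.1 ha i) (mem_iInter.1 hb i)).trans ?_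
  gcongr
  exact Finset.single_le_sum (f := K) (fun _ _ => zero_le) (Finset.mem_univ i)

/-- The negative logarithm of the loss. -/
noncomputable def negLogLoss (φ : ℝ → ℝ) (F : Fin m → V → ℝ) (w : V) : ℝ :=
  -Real.log (∑ i, Real.exp (-φ (F i w)))

theorem sum_exp_pos [NeZero m] (u : Fin m → ℝ) : 0 < ∑ i, Real.exp (u i) :=
  Finset.sum_pos (fun _ _ => Real.exp_pos _) ⟨0, Finset.mem_univ _⟩

omit [InnerProductSpace ℝ V] in
theorem locallyLipschitz_negLogLoss [NeZero m] {φ : ℝ → ℝ} (hφ : IsLossExponent φ)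
    {F : Fin m → V → ℝ} (hF : ∀ i, LocallyLipschitz (F i)) :
    LocallyLipschitz (negLogLoss φ F) := by
  have h1 : ContDiff ℝ 1 fun u : Fin m → ℝ => -Real.log (∑ i, Real.exp (-φ (u i))) := by
    have hφ1 : ContDiff ℝ 1 φ := hφ.1.of_le (by norm_num)
    refine (ContDiff.log ?_ fun u => (sum_exp_pos _).ne').neg
    fun_prop
  exact h1.locallyLipschitz.comp (LocallyLipschitz.pi hF)

omit [NormedAddCommGroup V] [InnerProductSpace ℝ V] in
theorem negLogLoss_le [NeZero m] (φ : ℝ → ℝ) (F : Fin m → V → ℝ) (w : V) (j : Fin m) :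
    negLogLoss φ F w ≤ φ (F j w) := by
  rw [negLogLoss, neg_le]
  conv_lhs => rw [← Real.log_exp (-φ (F j w))]
  exact Real.log_le_log (Real.exp_pos _)
    (Finset.single_le_sum (f := fun i => Real.exp (-φ (F i w)))
      (fun _ _ => (Real.exp_pos _).le) (Finset.mem_univ j))

end LogLoss

theorem IsNorm.eq_one_of_direction {V : Type*} [NormedAddCommGroup V] [InnerProductSpace ℝ V]
    [FiniteDimensional ℝ V] {N : V → ℝ} (hN : IsNorm N) {θ : ℝ → V} {θbar : V}
    (hθ : IsNontrivial N θ) (hdir : Tendsto (fun t => (N (θ t))⁻¹ • θ t) atTop (𝓝 θbar)) :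
    N θbar = 1 := by
  obtain ⟨a, ha, t₀, -, ht⟩ := hθ
  refine tendsto_nhds_unique ((hN.continuous.tendsto _).comp hdir) ?_
  refine tendsto_const_nhds.congr' ?_
  filter_upwards [eventually_ge_atTop t₀] with t htt
  have h0 : 0 < N (θ t) := ha.trans_le (ht t htt)
  rw [Function.comp_apply, hN.smul_of_nonneg (by positivity), inv_mul_cancel₀ h0.ne']

/-! ### Growth of the log-loss and stationarity of the limit direction -/

namespace IsDirectionalTrajectory

variable {V : Type*} [NormedAddCommGroup V] [InnerProductSpace ℝ V] {m : ℕ}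
  {N : V → ℝ} {φ : ℝ → ℝ} {F : Fin m → V → ℝ} {L c : ℝ} {η : ℝ → ℝ} {θ g : ℝ → V}
  {k : Fin m → ℝ → V} {kbar : Fin m → V} {θbar : V}
  (h : IsDirectionalTrajectory N φ F L c η θ g k kbar θbar)
include h

theorem hasDerivAt_negLogLoss [NeZero m] {t : ℝ} (ht : 0 ≤ t) {v : V}
    (hd : ∀ i, HasDerivAt (fun s => F i (θ s)) (η t * inner ℝ (k i t) v) t) :
    HasDerivAt (fun s => negLogLoss φ F (θ s))
      (η t * inner ℝ v (-g t) / ∑ i, Real.exp (-φ (F i (θ t)))) t := by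
  have h1 : ∀ i ∈ Finset.univ, HasDerivAt (fun s => Real.exp (-φ (F i (θ s))))
      (Real.exp (-φ (F i (θ t))) * -(deriv φ (F i (θ t)) * (η t * inner ℝ (k i t) v))) t :=
    fun i _ => ((h.exponent.differentiable _).hasDerivAt.comp t (hd i)).neg.exp
  have h2 := ((HasDerivAt.fun_sum h1).log (sum_exp_pos _).ne').neg
  have heq : -((∑ i, Real.exp (-φ (F i (θ t))) * -(deriv φ (F i (θ t)) *
      (η t * inner ℝ (k i t) v))) / ∑ i, Real.exp (-φ (F i (θ t)))) =
      η t * inner ℝ v (-g t) / ∑ i, Real.exp (-φ (F i (θ t))) := by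
    rw [h.g_eq t ht, neg_neg, inner_sum, ← neg_div, ← Finset.sum_neg_distrib, Finset.mul_sum]
    congr 1
    refine Finset.sum_congr rfl fun i _ => ?_
    rw [real_inner_smul_right, real_inner_comm]
    ring
  rw [heq] at h2
  exact h2

theorem norm_direction [FiniteDimensional ℝ V] : N θbar = 1 :=
  h.isNorm.eq_one_of_direction h.nontrivial h.direction

variable [FiniteDimensional ℝ V] [NeZero m]

/-- A lower bound for the momentum in the steepest direction gives a lower bound for the rate of
decrease of the logarithm of the loss. -/
theorem exists_ae_le_deriv_negLogLoss {κ κ' b : ℝ} (hκ' : 0 ≤ κ') (hκ : κ' < κ)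
    (hbφ : ∀ᶠ t in atTop, ∀ i, b ≤ deriv φ (F i (θ t)))
    (hm : ∀ᶠ t in atTop, ∃ w, N w = 1 ∧
      κ * ∑ i, weight N φ F L i (θ t) ≤ inner ℝ w (-momentum c g t)) :
    ∃ T, 0 < T ∧ ∀ᵐ t, T ≤ t →
      κ' * b * (N (θ t) ^ (L - 1) * η t) ≤ deriv (fun s => negLogLoss φ F (θ s)) t := by
  obtain ⟨D, hD, hDv⟩ := h.isNorm.exists_norm_le_mul
  -- Momentum and gradient are both within εQ of the frozen gradient and ‖v‖ ≤ D, so exchanging them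
  -- costs at most 2DεQ = (κ - κ')Q.
  set ε := (κ - κ') / (2 * D) with hε
  have hε0 : 0 < ε := by have := sub_pos.2 hκ; positivity
  obtain ⟨T₀, hT₀⟩ := eventually_atTop.1 ((((h.gradient_asymptotics hε0).and
    (h.momentum_asymptotics hε0)).and (hbφ.and hm)).and (h.eventually_norm_pos.and h.weight_pos))
  refine ⟨max T₀ 1, by positivity, ?_⟩
  filter_upwards [h.ae_hasDerivAt] with t hae ht
  have ht1 : 1 ≤ t := (le_max_right _ _).trans ht
  obtain ⟨⟨⟨hg, hmA⟩, hb', w, hw1, hw⟩, hN, hq⟩ := hT₀ t ((le_max_left _ _).trans ht)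
  obtain ⟨v, hv1, hv, -, hd⟩ := hae (by linarith)
  have hη := h.η_pos t (by linarith)
  set Q := ∑ i, weight N φ F L i (θ t) with hQ
  have hQ0 : 0 ≤ Q := Finset.sum_nonneg fun i _ => (hq i).le
  have hr : 0 < N (θ t) ^ (L - 1) := by positivity
  have hloss := sum_exp_pos (fun i => -φ (F i (θ t)))
  rw [(h.hasDerivAt_negLogLoss (by linarith) hd).deriv]
  have h1 : κ' * Q ≤ inner ℝ v (-g t) := by
    have h2 : κ * Q ≤ inner ℝ v (-momentum c g t) := hw.trans (hv w hw1)
    have h3 : ‖momentum c g t - g t‖ ≤ 2 * ε * Q := by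
      have := norm_sub_le_norm_sub_add_norm_sub (momentum c g t)
        (-∑ i, weight N φ F L i (θ t) • kbar i) (g t)
      rw [norm_sub_rev] at hg
      linarith
    have h4 : |inner ℝ v (momentum c g t - g t)| ≤ D * (2 * ε * Q) := by
      have hv' : ‖v‖ ≤ D := by simpa [hv1] using hDv v
      exact (abs_real_inner_le_norm _ _).trans (mul_le_mul hv' h3 (norm_nonneg _) hD.le)
    have h5 : inner ℝ v (-g t) =
        inner ℝ v (-momentum c g t) + inner ℝ v (momentum c g t - g t) := by
      rw [← inner_add_right]; congr 1; abel
    have h6 : D * (2 * ε * Q) = (κ - κ') * Q := by rw [hε]; field_simp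
    have := (abs_le.1 h4).1
    rw [h5]
    linarith
  have h2 : b * N (θ t) ^ (L - 1) * ∑ i, Real.exp (-φ (F i (θ t))) ≤ Q := by
    rw [Finset.mul_sum, hQ]
    refine Finset.sum_le_sum fun i _ => ?_
    rw [weight]
    calc b * N (θ t) ^ (L - 1) * Real.exp (-φ (F i (θ t)))
        = Real.exp (-φ (F i (θ t))) * b * N (θ t) ^ (L - 1) := by ring
      _ ≤ _ := by gcongr; exact hb' i
  rw [le_div_iff₀ hloss]
  calc κ' * b * (N (θ t) ^ (L - 1) * η t) * ∑ i, Real.exp (-φ (F i (θ t)))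
      = η t * (κ' * (b * N (θ t) ^ (L - 1) * ∑ i, Real.exp (-φ (F i (θ t))))) := by ring
    _ ≤ η t * (κ' * Q) := by gcongr
    _ ≤ η t * inner ℝ v (-g t) := by gcongr

/-- θbar serves as test direction: Euler's identity gives ⟨kbar_i, θbar⟩ = L F_i(θbar) ≥ Lγ. -/
theorem eventually_le_inner_momentum {γ ε : ℝ} (hε : 0 < ε) (hγ : ∀ i, γ ≤ F i θbar) :
    ∀ᶠ t in atTop, (L * γ - ε) * ∑ i, weight N φ F L i (θ t) ≤
      inner ℝ θbar (-momentum c g t) := by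
  have hL0 : 0 < L := one_pos.trans_le h.one_le
  have hε' : 0 < ε / (‖θbar‖ + 1) := by positivity
  filter_upwards [h.momentum_asymptotics hε', h.weight_pos] with t ht hq
  set Q := ∑ i, weight N φ F L i (θ t) with hQ
  have hQ0 : 0 ≤ Q := Finset.sum_nonneg fun i _ => (hq i).le
  have h1 : inner ℝ θbar (-momentum c g t) =
      inner ℝ θbar (∑ i, weight N φ F L i (θ t) • kbar i) -
      inner ℝ θbar (momentum c g t - -∑ i, weight N φ F L i (θ t) • kbar i) := by
    rw [← inner_sub_right]; congr 1; abel
  have h2 : L * γ * Q ≤ inner ℝ θbar (∑ i, weight N φ F L i (θ t) • kbar i) := by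
    rw [inner_sum, hQ, Finset.mul_sum]
    refine Finset.sum_le_sum fun i _ => ?_
    rw [real_inner_smul_right, real_inner_comm, h.euler i, mul_comm]
    have := hγ i
    have := hq i
    gcongr
  have h3 : inner ℝ θbar (momentum c g t - -∑ i, weight N φ F L i (θ t) • kbar i) ≤ ε * Q := by
    refine (real_inner_le_norm _ _).trans ?_
    calc ‖θbar‖ * _ ≤ (‖θbar‖ + 1) * (ε / (‖θbar‖ + 1) * Q) := by
          gcongr; linarith
      _ = ε * Q := by field_simp
  rw [h1]
  linarith

omit [FiniteDimensional ℝ V] in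
/-- Along the trajectory `-log` of the loss is at most `φ(0) + β (γ + e) ‖θ‖^L`. -/
theorem eventually_negLogLoss_le {β γ e : ℝ} (he : 0 < e) (hβ0 : 0 ≤ β)
    (hβ : ∀ z, deriv φ z ≤ β) {j : Fin m} (hj : F j θbar = γ) :
    ∀ᶠ t in atTop, negLogLoss φ F (θ t) ≤ φ 0 + β * (γ + e) * N (θ t) ^ L := by
  filter_upwards [h.eventually_eq_rpow_mul, h.eventually_norm_pos, h.eventually_margin_pos,
    (h.tendsto_margin j).eventually (gt_mem_nhds (show F j θbar < γ + e by linarith))]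
    with t h1 h2 h3 h4
  refine (negLogLoss_le φ F (θ t) j).trans ?_
  have h5 := image_sub_le_mul_sub_of_deriv_le h.exponent.differentiable hβ (h3 j).le
  have h6 : F j (θ t) ≤ N (θ t) ^ L * (γ + e) := by
    rw [h1 j]
    have : 0 ≤ N (θ t) ^ L := by positivity
    gcongr
  have h7 : β * (F j (θ t) - 0) ≤ β * (N (θ t) ^ L * (γ + e)) := by
    rw [sub_zero]; gcongr
  linarith

/-- The derivative of -log ℒ is at least a constant times η and ∫η = ∞, so -log ℒ → ∞; it is bounded
above by an affine function of N^L. -/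
theorem tendsto_norm_rpow : Tendsto (fun t => N (θ t) ^ L) atTop atTop := by
  obtain ⟨j, hj⟩ := Finite.exists_min fun i => F i θbar
  set γ := F j θbar with hγ
  have hγ0 : 0 < γ := h.margin_pos j
  have hL0 : 0 < L := one_pos.trans_le h.one_le
  have hLγ : 0 < L * γ := by positivity
  have hb0 : 0 < deriv φ 0 := h.exponent.deriv_pos 0
  obtain ⟨a, ha, hlow⟩ := h.exists_lower
  obtain ⟨β, hβ0, -, hβ⟩ := h.exponent.exists_limit
  obtain ⟨T₁, hT₁0, hT₁⟩ := h.exists_ae_le_deriv_negLogLoss (κ := L * γ / 2) (κ' := L * γ / 4)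
    (b := deriv φ 0) (by positivity) (by linarith)
    (h.eventually_margin_pos.mono fun t ht i => h.exponent.monotone_deriv (ht i).le)
    ((h.eventually_le_inner_momentum (half_pos hLγ) hj).mono fun t ht =>
      ⟨θbar, h.norm_direction, by convert ht using 2; ring⟩)
  obtain ⟨T₂, hT₂⟩ := eventually_atTop.1 hlow
  set T := max T₁ T₂
  have hT0 : 0 < T := hT₁0.trans_le (le_max_left _ _)
  set C := L * γ / 4 * deriv φ 0 * a ^ (L - 1) with hC
  have hC0 : 0 < C := by positivity
  -- The integral of a non-integrable function is 0 by convention, so divergence of ∫η itself yields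
  -- integrability on late intervals.
  have hηint : ∀ᶠ t in atTop, IntervalIntegrable η volume 0 t := by
    filter_upwards [h.schedule.1.eventually (eventually_gt_atTop 0)] with t ht
    by_contra hcon
    rw [intervalIntegral.integral_undef hcon] at ht
    exact lt_irrefl _ ht
  have hlower : ∀ᶠ t in atTop, negLogLoss φ F (θ T) + C * ((∫ s in (0 : ℝ)..t, η s) -
      ∫ s in (0 : ℝ)..T, η s) ≤ negLogLoss φ F (θ t) := by
    filter_upwards [hηint, eventually_ge_atTop T] with t hint ht
    have hi1 : IntervalIntegrable η volume 0 T :=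
      hint.mono_set (uIcc_subset_uIcc_left (mem_uIcc.2 (Or.inl ⟨hT0.le, ht⟩)))
    have hac := h.arc.absolutelyContinuousOnInterval_comp
      (locallyLipschitz_negLogLoss h.exponent h.lip) hT0.le (hT0.le.trans ht)
    rw [intervalIntegral.integral_interval_sub_left hint hi1, ← intervalIntegral.integral_const_mul,
      ← sub_nonneg, ← sub_sub, ← hac.integral_deriv_eq_sub, sub_nonneg]
    refine intervalIntegral.integral_mono_ae_restrict ht ((hi1.symm.trans hint).const_mul C)
      hac.intervalIntegrable_deriv ?_
    rw [EventuallyLE, ae_restrict_iff' measurableSet_Icc]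
    filter_upwards [hT₁] with s hs hsT
    refine le_trans ?_ (hs ((le_max_left _ _).trans hsT.1))
    have h1 : a ^ (L - 1) ≤ N (θ s) ^ (L - 1) := by
      have := hT₂ s ((le_max_right _ _).trans hsT.1)
      gcongr
      linarith [h.one_le]
    have h2 := h.η_pos s (hT0.trans_le hsT.1)
    rw [hC, mul_assoc (L * γ / 4 * deriv φ 0)]
    gcongr
  have hG : Tendsto (fun t => negLogLoss φ F (θ t)) atTop atTop := by
    refine tendsto_atTop_mono' _ hlower (tendsto_atTop_add_const_left _ _ ?_)
    exact (tendsto_atTop_add_const_right _ _ h.schedule.1).const_mul_atTop hC0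
  have hpos : 0 < β * (γ + 1) := by positivity
  refine tendsto_atTop_mono' _ ?_ ((tendsto_atTop_add_const_right _ (-φ 0) hG).atTop_div_const hpos)
  filter_upwards [h.eventually_negLogLoss_le one_pos hβ0.le hβ hγ.symm] with t ht
  rw [div_le_iff₀ hpos]
  linarith

theorem tendsto_margins (i : Fin m) : Tendsto (fun t => F i (θ t)) atTop atTop := by
  refine (h.tendsto_norm_rpow.atTop_mul_pos (h.margin_pos i) (h.tendsto_margin i)).congr' ?_
  filter_upwards [h.eventually_eq_rpow_mul] with t ht using (ht i).symm

omit [NeZero m] in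
theorem locallyLipschitz_norm_rpow : LocallyLipschitz fun w => N w ^ L := by
  have h1 : ContDiff ℝ 1 fun r : ℝ => r ^ L :=
    Real.contDiff_rpow_const_of_le (by simpa using h.one_le)
  exact h1.locallyLipschitz.comp h.locallyLipschitz_norm

/-- The dual norm of the momentum is, at arbitrarily late times, almost the margin. -/
theorem exists_inner_momentum_le {γ e : ℝ} (he : 0 < e) (hγ0 : 0 < γ) {j : Fin m}
    (hj : F j θbar = γ) (T₀ : ℝ) : ∃ t, T₀ ≤ t ∧ ∀ w, N w = 1 →
      inner ℝ w (-momentum c g t) ≤ L * (γ + 4 * e) * ∑ i, weight N φ F L i (θ t) := by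
  by_contra! hcon
  have hL0 : 0 < L := one_pos.trans_le h.one_le
  obtain ⟨β, hβ0, hβlim, hβ⟩ := h.exponent.exists_limit
  -- The lower bound b for φ' is chosen so that L(γ + 3e) · b = Lβ(γ + 2e); the factor η N^{L-1}
  -- times this dominates the derivative of β(γ + 2e) N^L.
  have hb : (γ + 2 * e) / (γ + 3 * e) < 1 := by
    rw [div_lt_one (by positivity)]; linarith
  have hbβ : β * ((γ + 2 * e) / (γ + 3 * e)) < β := mul_lt_of_lt_one_right hβ0 hb
  obtain ⟨T₁, hT₁0, hT₁⟩ := h.exists_ae_le_deriv_negLogLoss (κ := L * (γ + 4 * e))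
    (κ' := L * (γ + 3 * e)) (b := β * ((γ + 2 * e) / (γ + 3 * e))) (by positivity)
    (by gcongr; linarith)
    (eventually_all.2 fun i => ((hβlim.comp (h.tendsto_margins i)).eventually
      (lt_mem_nhds hbβ)).mono fun t ht => ht.le)
    (eventually_atTop.2 ⟨T₀, fun t ht =>
      let ⟨w, hw, hlt⟩ := hcon t ht
      ⟨w, hw, hlt.le⟩⟩)
  obtain ⟨T₂, hT₂⟩ := eventually_atTop.1 h.eventually_norm_pos
  set T := max T₁ T₂
  have hT0 : 0 < T := hT₁0.trans_le (le_max_left _ _)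
  have hlower : ∀ t, T ≤ t → β * (γ + 2 * e) * N (θ t) ^ L - β * (γ + 2 * e) * N (θ T) ^ L ≤
      negLogLoss φ F (θ t) - negLogLoss φ F (θ T) := by
    intro t ht
    refine AbsolutelyContinuousOnInterval.sub_le_sub
      (u := fun s => β * (γ + 2 * e) * N (θ s) ^ L) ht
      ((h.arc.absolutelyContinuousOnInterval_comp h.locallyLipschitz_norm_rpow hT0.le
        (hT0.le.trans ht)).const_mul _)
      (h.arc.absolutelyContinuousOnInterval_comp
        (locallyLipschitz_negLogLoss h.exponent h.lip) hT0.le (hT0.le.trans ht)) ?_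
    filter_upwards [hT₁, h.ae_abs_deriv_norm_le,
      h.arc.ae_differentiableAt_comp h.locallyLipschitz_norm] with s hs hN hd hsT
    have hs0 : 0 < s := hT0.trans_le hsT.1
    have hr := hT₂ s ((le_max_right _ _).trans hsT.1)
    refine le_trans ?_ (hs ((le_max_left _ _).trans hsT.1))
    have hder := ((hd hs0.le).hasDerivAt.rpow_const (p := L) (Or.inl hr.ne')).const_mul
      (β * (γ + 2 * e))
    rw [hder.deriv]
    have h1 := (le_abs_self _).trans (hN hs0)
    calc β * (γ + 2 * e) * (deriv (fun s => N (θ s)) s * L * N (θ s) ^ (L - 1))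
        ≤ β * (γ + 2 * e) * (η s * L * N (θ s) ^ (L - 1)) := by gcongr
      _ = _ := by field_simp
  -- Growth with slope β(γ + 2e) in N^L meets the ceiling of slope β(γ + e): impossible once βe N^L
  -- exceeds the additive constants.
  obtain ⟨t, ⟨ht1, ht2⟩, ht3⟩ := (((eventually_ge_atTop T).and
    (h.eventually_negLogLoss_le he hβ0.le hβ hj)).and
    (h.tendsto_norm_rpow.eventually (eventually_gt_atTop
      ((φ 0 - negLogLoss φ F (θ T) + β * (γ + 2 * e) * N (θ T) ^ L) / (β * e))))).exists
  have h1 := hlower t ht1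
  rw [div_lt_iff₀ (by positivity)] at ht3
  linarith

/-- The limit direction satisfies the stationarity conditions of the max-margin problem. -/
theorem exists_multipliers {γ : ℝ} (hγ : ∀ i, γ ≤ F i θbar) {j : Fin m} (hj : F j θbar = γ) :
    ∃ lam : Fin m → ℝ, (∀ i, 0 ≤ lam i) ∧ ∑ i, lam i = 1 ∧
      (∀ w, inner ℝ w (∑ i, lam i • kbar i) ≤ L * γ * N w) ∧ ∑ i, lam i * F i θbar = γ := by
  have hL0 : 0 < L := one_pos.trans_le h.one_le
  have hγ0 : 0 < γ := hj ▸ h.margin_pos j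
  obtain ⟨D, hD, hDv⟩ := h.isNorm.exists_norm_le_mul
  have hex : ∀ n : ℕ, ∃ lam ∈ stdSimplex ℝ (Fin m), ∀ w, N w = 1 →
      inner ℝ w (∑ i, lam i • kbar i) ≤ L * (γ + 4 * (1 / ((n : ℝ) + 1))) +
        D * (1 / ((n : ℝ) + 1)) := by
    intro n
    set e : ℝ := 1 / ((n : ℝ) + 1)
    have he : 0 < e := by positivity
    obtain ⟨T, hT⟩ := eventually_atTop.1
      ((h.momentum_asymptotics he).and (h.weight_pos.and h.sum_weight_pos))
    obtain ⟨t, htT, ht⟩ := h.exists_inner_momentum_le he hγ0 hj T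
    obtain ⟨hm, hq, hQ⟩ := hT t htT
    set Q := ∑ i, weight N φ F L i (θ t) with hQdef
    -- The approximate multipliers are the normalized weights; they lie in the compact simplex.
    refine ⟨fun i => weight N φ F L i (θ t) / Q, ⟨fun i => (div_pos (hq i) hQ).le, ?_⟩,
      fun w hw => ?_⟩
    · rw [← Finset.sum_div, ← hQdef, div_self hQ.ne']
    · have h1 : inner ℝ w (∑ i, weight N φ F L i (θ t) • kbar i) =
          inner ℝ w (-momentum c g t) +
          inner ℝ w (momentum c g t - -∑ i, weight N φ F L i (θ t) • kbar i) := by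
        rw [← inner_add_right]; congr 1; abel
      have hwD : ‖w‖ ≤ D := by simpa [hw] using hDv w
      have h2 : inner ℝ w (momentum c g t - -∑ i, weight N φ F L i (θ t) • kbar i) ≤
          D * (e * Q) :=
        (real_inner_le_norm _ _).trans (mul_le_mul hwD hm (norm_nonneg _) hD.le)
      have h3 : ∑ i, (weight N φ F L i (θ t) / Q) • kbar i =
          Q⁻¹ • ∑ i, weight N φ F L i (θ t) • kbar i := by
        rw [Finset.smul_sum]
        exact Finset.sum_congr rfl fun i _ => by rw [smul_smul, div_eq_inv_mul]
      rw [h3, real_inner_smul_right, inv_mul_le_iff₀ hQ, h1]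
      linarith [ht w hw]
  choose lamn hmem hle using hex
  obtain ⟨lam, hlam, ψ, hψ, hlim⟩ := (isCompact_stdSimplex ℝ (Fin m)).tendsto_subseq hmem
  have hsum : Tendsto (fun n => ∑ i, lamn (ψ n) i • kbar i) atTop (𝓝 (∑ i, lam i • kbar i)) :=
    tendsto_finsetSum _ fun i _ => ((continuous_apply i).tendsto _ |>.comp hlim).smul_const _
  have hunit : ∀ w, N w = 1 → inner ℝ w (∑ i, lam i • kbar i) ≤ L * γ := by
    intro w hw
    have hτ := (tendsto_one_div_add_atTop_nhds_zero_nat (𝕜 := ℝ)).comp hψ.tendsto_atTop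
    have hrhs : Tendsto (fun n : ℕ => L * (γ + 4 * (1 / ((ψ n : ℝ) + 1))) +
        D * (1 / ((ψ n : ℝ) + 1))) atTop (𝓝 (L * γ)) := by
      simpa using! (((hτ.const_mul 4).const_add γ).const_mul L).add (hτ.const_mul D)
    exact le_of_tendsto_of_tendsto (tendsto_const_nhds.inner hsum) hrhs
      (Eventually.of_forall fun n => hle _ w hw)
  refine ⟨lam, hlam.1, hlam.2, fun w => ?_, le_antisymm ?_ ?_⟩
  · rcases eq_or_ne w 0 with rfl | hw
    · simp [h.isNorm.map_zero]
    have hp := h.isNorm.pos hw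
    have h1 := hunit ((N w)⁻¹ • w)
      (by rw [h.isNorm.smul_of_nonneg (by positivity), inv_mul_cancel₀ hp.ne'])
    rw [real_inner_smul_left, inv_mul_le_iff₀ hp] at h1
    linarith
  -- Testing the dual bound at θbar itself turns it, by Euler, into the upper bound; minimality of γ
  -- gives the reverse.
  · have h1 := hunit θbar h.norm_direction
    have h2 : inner ℝ θbar (∑ i, lam i • kbar i) = L * ∑ i, lam i * F i θbar := by
      rw [inner_sum, Finset.mul_sum]
      refine Finset.sum_congr rfl fun i _ => ?_
      rw [real_inner_smul_right, real_inner_comm, h.euler i]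
      ring
    rw [h2] at h1
    exact le_of_mul_le_mul_left h1 hL0
  · calc γ = ∑ i, lam i * γ := by rw [← Finset.sum_mul, hlam.2, one_mul]
      _ ≤ _ := Finset.sum_le_sum fun i _ => mul_le_mul_of_nonneg_left (hγ i) (hlam.1 i)

end IsDirectionalTrajectory

/-! ### From the limit direction to a KKT point -/

section KKT

variable {V : Type*} [NormedAddCommGroup V] [InnerProductSpace ℝ V] [FiniteDimensional ℝ V]
  [CompleteSpace V] {X : Type*} {m : ℕ}

omit [InnerProductSpace ℝ V] [FiniteDimensional ℝ V] [CompleteSpace V] in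
theorem locallyLipschitz_const_mul {F : V → ℝ} (hF : LocallyLipschitz F) (a : ℝ) :
    LocallyLipschitz fun w => a * F w := by
  have h1 : ContDiff ℝ 1 fun r : ℝ => a * r := by fun_prop
  exact h1.locallyLipschitz.comp hF

omit [InnerProductSpace ℝ V] [FiniteDimensional ℝ V] [CompleteSpace V] in
theorem locallyLipschitz_loss {φ : ℝ → ℝ} (hφ : IsLossExponent φ) {f : X → V → ℝ}
    (hf : ∀ ξ, LocallyLipschitz (f ξ)) (x : Fin m → X) (y : Fin m → ℝ) :
    LocallyLipschitz (loss φ f x y) := by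
  have h1 : ContDiff ℝ 1 fun u : Fin m → ℝ => ∑ i, Real.exp (-φ (u i)) := by
    have hφ1 : ContDiff ℝ 1 φ := hφ.1.of_le (by norm_num)
    fun_prop
  exact h1.locallyLipschitz.comp
    (LocallyLipschitz.pi fun i => locallyLipschitz_const_mul (hf (x i)) (y i))

omit [FiniteDimensional ℝ V] in
theorem gradient_loss {φ : ℝ → ℝ} (hφ : IsLossExponent φ) {f : X → V → ℝ}
    (hf : ∀ ξ, ContDiff ℝ 1 (f ξ)) (x : Fin m → X) (y : Fin m → ℝ) (w : V) :
    gradient (loss φ f x y) w = -∑ i, (Real.exp (-φ (y i * f (x i) w)) *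
      deriv φ (y i * f (x i) w) * y i) • gradient (f (x i)) w := by
  refine HasGradientAt.gradient ?_
  rw [hasGradientAt_iff_hasFDerivAt]
  have h1 : ∀ i ∈ Finset.univ, HasFDerivAt (fun w => Real.exp (-φ (y i * f (x i) w)))
      (Real.exp (-φ (y i * f (x i) w)) • -(deriv φ (y i * f (x i) w) •
        (y i • fderiv ℝ (f (x i)) w))) w := by
    intro i _
    have h2 := (((hf (x i)).differentiable one_ne_zero w).hasFDerivAt).const_mul (y i)
    exact ((hφ.differentiable _).hasDerivAt.comp_hasFDerivAt w h2).neg.exp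
  refine (HasFDerivAt.fun_sum h1).congr_fderiv ?_
  simp only [map_neg, map_sum, map_smul, toDual_gradient, smul_neg, Finset.sum_neg_distrib,
    smul_smul, mul_assoc]

omit [FiniteDimensional ℝ V] in
-- The arc stays in a compact set up to time t, where Clarke subgradients are bounded.
theorem IsMomentumSetup.intervalIntegrable {ℒ : V → ℝ} {c : ℝ} {η : ℝ → ℝ} {θ g : ℝ → V}
    (h : IsMomentumSetup ℒ c η θ g) (hℒ : LocallyLipschitz ℒ) {t : ℝ} (ht : 0 ≤ t) :
    IntervalIntegrable g volume 0 t := by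
  obtain ⟨C, hC⟩ := exists_norm_le_of_isCompact hℒ
    (isCompact_Icc.image_of_continuousOn (h.arc.continuousOn ht))
  rw [intervalIntegrable_iff_integrableOn_Ioc_of_le ht]
  refine IntegrableOn.of_bound measure_Ioc_lt_top (h.measurable_g.mono_measure
    (Measure.restrict_mono (fun s hs => hs.1.le) le_rfl)) C ?_
  refine (ae_restrict_iff' measurableSet_Ioc).2 (Eventually.of_forall fun s hs => ?_)
  exact hC _ (mem_image_of_mem _ ⟨hs.1.le, hs.2⟩) _ (h.g_mem s hs.1.le)

omit [FiniteDimensional ℝ V] in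
-- A C¹ gradient is continuous and homogeneous of degree L - 1, so its normalized values converge
-- with the direction. Thus the smooth case needs no separate argument.
theorem SubgradientsConverge.of_contDiff {N : V → ℝ} {φ : ℝ → ℝ}
    (hφ : IsLossExponent φ)
    {f : X → V → ℝ} (hf : ∀ ξ, ContDiff ℝ 1 (f ξ)) {x : Fin m → X} {y : Fin m → ℝ} {c L : ℝ}
    {η : ℝ → ℝ} {θ g : ℝ → V} {θbar : V} (hset : IsMomentumSetup (loss φ f x y) c η θ g)
    (hhom : IsHomogeneous f L) (hnt : IsNontrivial N θ)
    (hdir : Tendsto (fun t => (N (θ t))⁻¹ • θ t) atTop (𝓝 θbar)) :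
    SubgradientsConverge N φ f x y L θ g := by
  have hloss : ContDiff ℝ 1 (loss φ f x y) := by
    have hφ1 : ContDiff ℝ 1 φ := hφ.1.of_le (by norm_num)
    unfold loss
    fun_prop
  refine ⟨fun i t => gradient (f (x i)) (θ t), fun i t _ => subset_convexHull ℝ _
    (mem_limitingGradients_of_differentiableAt ((hf _).differentiable one_ne_zero _)),
    fun t ht => ?_, fun i => ⟨gradient (f (x i)) θbar, ?_⟩⟩
  · rw [mem_singleton_iff.1 (clarkeSubdiff_subset_singleton hloss _ (hset.g_mem t ht)),
      gradient_loss hφ hf]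
  · have hc : Continuous (gradient (f (x i))) :=
      (LinearIsometryEquiv.continuous _).comp ((hf _).continuous_fderiv one_ne_zero)
    refine ((hc.tendsto _).comp hdir).congr' ?_
    obtain ⟨a, ha, t₀, -, ht⟩ := hnt
    filter_upwards [eventually_ge_atTop t₀] with t htt
    have h0 : 0 < N (θ t) := ha.trans_le (ht t htt)
    rw [Function.comp_apply, (gradient_smul_of_homogeneous (hhom (x i)) (inv_pos.2 h0)
      ((hf _).differentiable one_ne_zero _)).2, Real.inv_rpow h0.le]

/-- The limit of normalized subgradients is a subgradient at the limit direction. -/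
theorem mem_clarkeSubdiff_of_normalized_tendsto {N : V → ℝ} {F : V → ℝ}
    (hF : LocallyLipschitz F) {L : ℝ}
    (hhom : ∀ (w : V) (a : ℝ), 0 < a → F (a • w) = a ^ L * F w) {θ : ℝ → V} {θbar l : V}
    {k : ℝ → V} (hnt : IsNontrivial N θ)
    (hdir : Tendsto (fun t => (N (θ t))⁻¹ • θ t) atTop (𝓝 θbar))
    (hk : ∀ t, 0 ≤ t → k t ∈ clarkeSubdiff F (θ t))
    (hl : Tendsto (fun t => (N (θ t) ^ (L - 1))⁻¹ • k t) atTop (𝓝 l)) :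
    l ∈ clarkeSubdiff F θbar := by
  obtain ⟨a, ha, t₀, ht₀, ht⟩ := hnt
  have hseq : Tendsto (fun n : ℕ => (n : ℝ) + t₀) atTop atTop :=
    tendsto_atTop_add_const_right _ _ tendsto_natCast_atTop_atTop
  refine mem_clarkeSubdiff_of_tendsto hF (fun n => ?_) (hdir.comp hseq) (hl.comp hseq)
  have hn : t₀ ≤ (n : ℝ) + t₀ := by linarith [n.cast_nonneg (α := ℝ)]
  have h0 : 0 < N (θ (n + t₀)) := ha.trans_le (ht _ hn)
  rw [Function.comp_apply, Function.comp_apply, ← Real.inv_rpow h0.le]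
  exact smul_mem_clarkeSubdiff hhom (inv_pos.2 h0) (hk _ (ht₀.trans hn))

/-- The limit direction of normalized momentum steepest descent with respect to a norm is the
direction of a KKT point of the max-margin problem for that norm. -/
theorem IsNormalizedMSD.exists_isKKTPoint [NeZero m] {N : V → ℝ} {φ : ℝ → ℝ}
    (hφ : IsLossExponent φ) {f : X → V → ℝ} {x : Fin m → X} {y : Fin m → ℝ} {c L : ℝ}
    {η : ℝ → ℝ} {θ g : ℝ → V} {θbar : V} (h : IsNormalizedMSD N (loss φ f x y) c η θ g)
    (hL : 1 ≤ L) (hhom : IsHomogeneous f L) (hη : ScheduleCondition η L)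
    (hnt : IsNontrivial N θ) (hdir : ConvergesInDirection N f x y θ θbar)
    (hf : (∀ ξ, ContDiff ℝ 1 (f ξ)) ∨
      ((∀ ξ, LocallyLipschitz (f ξ) ∧ IsWhitneyC1Stratifiable (f ξ)) ∧
        SubgradientsConverge N φ f x y L θ g)) :
    ∃ a : ℝ, 0 < a ∧ IsKKTPoint N f x y (a • θbar) := by
  have hN := h.isNorm
  obtain ⟨hdir, hmargin⟩ := hdir
  have hlip : ∀ ξ, LocallyLipschitz (f ξ) := fun ξ =>
    hf.elim (fun h => (h ξ).locallyLipschitz) fun h => (h.1 ξ).1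
  have hchain : ∀ ξ, ∀ᵐ t, 0 ≤ t → ∀ v, HasDerivAt θ v t → ∀ l ∈ clarkeSubdiff (f ξ) (θ t),
      HasDerivAt (fun s => f ξ (θ s)) (inner ℝ l v) t := fun ξ =>
    hf.elim (fun h => IsArc.ae_hasDerivAt_of_contDiff (h ξ))
      fun hW => h.setup.arc.ae_hasDerivAt_of_whitney (hW.1 ξ).1 (hW.1 ξ).2
  have hconv : SubgradientsConverge N φ f x y L θ g :=
    hf.elim (fun hC => SubgradientsConverge.of_contDiff hφ hC h.setup hhom hnt hdir)
      fun h => h.2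
  obtain ⟨k, hk, hg, hkl⟩ := hconv
  choose l hl using hkl
  have hlmem : ∀ i, l i ∈ clarkeSubdiff (f (x i)) θbar := fun i =>
    mem_clarkeSubdiff_of_normalized_tendsto (hlip _) (hhom (x i)) hnt hdir (hk i) (hl i)
  have hθbar : N θbar = 1 := hN.eq_one_of_direction hnt hdir
  have hpos : ∀ i, 0 < y i * f (x i) θbar := by
    intro i
    refine hmargin.trans_le ?_
    have h1 := ciInf_le (Set.finite_range
      fun i => y i * f (x i) ((N θbar)⁻¹ • θbar)).bddBelow i
    simpa [margin, hθbar] using h1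
  have htraj : IsDirectionalTrajectory N φ (fun i w => y i * f (x i) w) L c η θ g
      (fun i t => y i • k i t) (fun i => y i • l i) θbar :=
    { isNorm := hN
      exponent := hφ
      one_le := hL
      lip := fun i => locallyLipschitz_const_mul (hlip _) _
      hom := fun i w a ha => by rw [hhom (x i) w a ha]; ring
      c_pos := h.setup.c_pos
      η_pos := h.setup.η_pos
      arc := h.setup.arc
      integrable := fun t ht =>
        h.setup.intervalIntegrable (locallyLipschitz_loss hφ hlip x y) ht
      g_eq := fun t ht => by simp only [hg t ht, smul_smul]
      chain := by
        filter_upwards [ae_all_iff.2 fun i => hchain (x i)] with t ht h0 v hv i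
        rw [real_inner_smul_left]
        exact (ht i h0 v hv _ (hk i t h0)).const_mul (y i)
      update := (ae_restrict_iff' measurableSet_Ici).1 h.update
      k_lim := fun i => by simpa only [smul_comm _ (y i)] using (hl i).const_smul (y i)
      schedule := hη
      nontrivial := hnt
      direction := hdir
      margin_pos := hpos
      euler := fun i => by
        rw [real_inner_smul_left, inner_eq_of_mem_clarkeSubdiff (hlip _).continuous
          (hhom (x i)) (hlmem i)]
        ring }
  obtain ⟨j, hj⟩ := Finite.exists_min fun i => y i * f (x i) θbar
  obtain ⟨lam, hlam0, hlam1, hlamle, hlamγ⟩ := htraj.exists_multipliers hj rfl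
  set γ := y j * f (x j) θbar with hγ
  have hγ0 : 0 < γ := hpos j
  have hL0 : 0 < L := one_pos.trans_le hL
  -- The scaling that brings the smallest margin to exactly 1.
  set a := (γ⁻¹) ^ (1 / L) with ha
  have ha0 : 0 < a := by positivity
  have haL : a ^ L * γ = 1 := by
    rw [ha, ← Real.rpow_mul (by positivity), one_div_mul_cancel hL0.ne', Real.rpow_one,
      inv_mul_cancel₀ hγ0.ne']
  have haL1 : a * a ^ (L - 1) = a ^ L := by
    rw [Real.rpow_sub_one ha0.ne']; field_simp
  have hNa : N (a • θbar) = a := by rw [hN.smul_of_nonneg ha0.le, hθbar, mul_one]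
  have hfa : ∀ i, y i * f (x i) (a • θbar) = a ^ L * (y i * f (x i) θbar) := fun i => by
    rw [hhom (x i) θbar a ha0]; ring
  -- Chosen so that sLγ = a = N(aθbar), the dual norm a subgradient of ½N² must have there. The
  -- factor a^{L-1} belongs to the rescaled subgradients, a²/L to the multipliers.
  set s := a ^ 2 / L * a ^ (L - 1) with hs
  have hs0 : 0 ≤ s := by positivity
  have hsγ : s * (L * γ) = a := by
    calc s * (L * γ) = a * ((a * a ^ (L - 1)) * γ) := by rw [hs]; field_simp
      _ = a := by rw [haL1, haL, mul_one]
  refine ⟨a, ha0, fun i => ?_, s • ∑ i, lam i • y i • l i,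
    hN.mem_clarkeSubdiff_half_sq (fun w => ?_) ?_, fun i => a ^ 2 / L * lam i,
    fun i => a ^ (L - 1) • l i, fun i => mul_nonneg (by positivity) (hlam0 i),
    fun i => smul_mem_clarkeSubdiff (hhom (x i)) ha0 (hlmem i), ?_, ?_⟩
  · rw [hfa, ← haL]
    have := hj i
    gcongr
  · rw [real_inner_smul_left, real_inner_comm, hNa]
    calc s * inner ℝ w (∑ i, lam i • y i • l i) ≤ s * (L * γ * N w) := by
          gcongr; exact hlamle w
      _ = a * N w := by rw [← mul_assoc, hsγ]
  · have h1 : inner ℝ (∑ i, lam i • y i • l i) θbar = L * γ := by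
      rw [sum_inner, ← hlamγ, Finset.mul_sum]
      refine Finset.sum_congr rfl fun i _ => ?_
      rw [real_inner_smul_left, htraj.euler i]
      ring
    rw [hNa, real_inner_smul_left, real_inner_smul_right, h1, mul_left_comm, hsγ, sq]
  · rw [sub_eq_zero, Finset.smul_sum]
    refine Finset.sum_congr rfl fun i _ => ?_
    simp only [smul_smul, hs]
    congr 1
    ring
  · calc ∑ i, a ^ 2 / L * lam i * (y i * f (x i) (a • θbar) - 1)
        = a ^ 2 / L * (a ^ L * ∑ i, lam i * (y i * f (x i) θbar) - ∑ i, lam i) := by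
          rw [Finset.mul_sum, ← Finset.sum_sub_distrib, Finset.mul_sum]
          refine Finset.sum_congr rfl fun i _ => ?_
          rw [hfa]
          ring
      _ = 0 := by
          rw [hlamγ, hlam1, haL, sub_self, mul_zero]

end KKT

/-! ### Muon directions and the spectral norm -/

section SpectralNorm

open scoped Matrix.Norms.L2Operator Matrix

theorem matSpectralNorm_eq_norm {p q : ℕ} (W : Matrix (Fin p) (Fin q) ℝ) :
    matSpectralNorm W = ‖W‖ := rfl

theorem norm_one_matrix_le (r : ℕ) : ‖(1 : Matrix (Fin r) (Fin r) ℝ)‖ ≤ 1 := by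
  rw [← Matrix.diagonal_one, Matrix.l2_opNorm_diagonal]
  exact (pi_norm_le_iff_of_nonneg zero_le_one).2 fun i => by simp

theorem norm_le_one_of_transpose_mul_self {p r : ℕ} {U : Matrix (Fin p) (Fin r) ℝ}
    (hU : U.transpose * U = 1) : ‖U‖ ≤ 1 ∧ ‖U.transpose‖ ≤ 1 := by
  have h1 : ‖U‖ * ‖U‖ ≤ 1 := by
    rw [← Matrix.l2_opNorm_conjTranspose_mul_self, Matrix.conjTranspose_eq_transpose_of_trivial, hU]
    exact norm_one_matrix_le r
  have h2 : ‖U‖ ≤ 1 := by nlinarith [norm_nonneg U]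
  refine ⟨h2, ?_⟩
  rwa [← Matrix.conjTranspose_eq_transpose_of_trivial, Matrix.l2_opNorm_conjTranspose]

theorem abs_entry_le_norm {p q : ℕ} (A : Matrix (Fin p) (Fin q) ℝ) (i : Fin p) (j : Fin q) :
    |A i j| ≤ ‖A‖ := by
  have h1 := Matrix.l2_opNorm_mulVec A (EuclideanSpace.single j (1 : ℝ))
  rw [PiLp.norm_single, norm_one, mul_one] at h1
  have h2 := PiLp.norm_apply_le ((EuclideanSpace.equiv (Fin p) ℝ).symm <|
    A *ᵥ (EuclideanSpace.single j (1 : ℝ))) i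
  refine le_trans (le_of_eq ?_) (h2.trans h1)
  simp

/-- The Frobenius inner product of two matrices. -/
def matInner {p q : ℕ} (W M : Matrix (Fin p) (Fin q) ℝ) : ℝ := ∑ i, ∑ j, W i j * M i j

/-- Cyclicity of the trace. -/
theorem matInner_svd {p q r : ℕ} (A : Matrix (Fin p) (Fin q) ℝ) (U : Matrix (Fin p) (Fin r) ℝ)
    (σ : Fin r → ℝ) (W : Matrix (Fin q) (Fin r) ℝ) :
    matInner A (U * Matrix.diagonal σ * W.transpose) =
      ∑ l, σ l * (U.transpose * A * W) l l := by
  have h1 : matInner A (U * Matrix.diagonal σ * W.transpose) =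
      (A.transpose * (U * Matrix.diagonal σ * W.transpose)).trace := by
    simp only [matInner, Matrix.trace, Matrix.diag_apply, Matrix.mul_apply (M := A.transpose),
      Matrix.transpose_apply]
    exact Finset.sum_comm
  have h2 : (A.transpose * (U * Matrix.diagonal σ * W.transpose)).trace =
      (Matrix.diagonal σ * (U.transpose * A * W).transpose).trace := by
    rw [Matrix.transpose_mul, Matrix.transpose_mul, Matrix.transpose_transpose,
      ← Matrix.mul_assoc, ← Matrix.mul_assoc, Matrix.trace_mul_comm, ← Matrix.mul_assoc,
      ← Matrix.mul_assoc, Matrix.trace_mul_comm]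
  rw [h1, h2]
  simp only [Matrix.trace, Matrix.diag_apply, Matrix.diagonal_mul, Matrix.transpose_apply]

/-- The diagonal entries of UᵀAW are at least -1 since ‖UᵀAW‖ ≤ 1, and D makes them all -1. The norm
of D is only bounded by 1, because D = 0 when M = 0. -/
theorem muonDirections_spec {p q : ℕ} {M D : Matrix (Fin p) (Fin q) ℝ}
    (hD : D ∈ muonDirections M) : matSpectralNorm D ≤ 1 ∧
      ∀ A : Matrix (Fin p) (Fin q) ℝ, matSpectralNorm A ≤ 1 → matInner D M ≤ matInner A M := by
  obtain ⟨r, U, σ, W, hU, hW, hσ, rfl, rfl⟩ := hD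
  have hU' := norm_le_one_of_transpose_mul_self hU
  have hW' := norm_le_one_of_transpose_mul_self hW
  refine ⟨?_, fun A hA => ?_⟩
  · rw [matSpectralNorm_eq_norm, norm_neg]
    exact (Matrix.l2_opNorm_mul _ _).trans
      (mul_le_one₀ hU'.1 (norm_nonneg _) hW'.2)
  · rw [matInner_svd, matInner_svd]
    refine Finset.sum_le_sum fun l _ => mul_le_mul_of_nonneg_left ?_ (hσ l).le
    have h1 : U.transpose * -(U * W.transpose) * W = -1 := by
      rw [Matrix.mul_neg, Matrix.neg_mul, ← Matrix.mul_assoc, hU, Matrix.one_mul, hW]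
    have h2 : ‖U.transpose * A * W‖ ≤ 1 := by
      refine (Matrix.l2_opNorm_mul _ _).trans (mul_le_one₀ ?_ (norm_nonneg _) hW'.1)
      exact (Matrix.l2_opNorm_mul _ _).trans (mul_le_one₀ hU'.2 (norm_nonneg _) hA)
    rw [h1]
    have h3 := (abs_le.1 ((abs_entry_le_norm (U.transpose * A * W) l l).trans h2)).1
    simpa using h3

end SpectralNorm

/-! ### The hybrid norm and its steepest directions -/

section HybridNorm

variable {K n : ℕ} {rows cols : Fin K → ℕ}

theorem abs_le_linftyNorm (u : EuclideanSpace ℝ (Fin n)) (j : Fin n) : |u j| ≤ linftyNorm u :=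
  le_ciSup (f := fun j => |u j|) (Set.finite_range _).bddAbove j

theorem linftyNorm_nonneg (u : EuclideanSpace ℝ (Fin n)) : 0 ≤ linftyNorm u :=
  Real.iSup_nonneg fun _ => abs_nonneg _

theorem linftyNorm_smul {a : ℝ} (ha : 0 ≤ a) (u : EuclideanSpace ℝ (Fin n)) :
    linftyNorm (a • u) = a * linftyNorm u := by
  simp only [linftyNorm, PiLp.smul_apply, smul_eq_mul, abs_mul, abs_of_nonneg ha]
  exact (Real.mul_iSup_of_nonneg ha _).symm

theorem hybridNorm_nonneg (θ : Params rows cols n) : 0 ≤ hybridNorm θ :=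
  (linftyNorm_nonneg _).trans (le_max_right _ _)

theorem matSpectralNorm_le_hybridNorm (θ : Params rows cols n) (k : Fin K) :
    matSpectralNorm (matPart θ k) ≤ hybridNorm θ :=
  (le_ciSup (f := fun k => matSpectralNorm (matPart θ k)) (Set.finite_range _).bddAbove k).trans
    (le_max_left _ _)

/-- Nonnegativity of `a` covers empty families of blocks or coordinates, whose supremum is 0. -/
theorem hybridNorm_le_iff {θ : Params rows cols n} {a : ℝ} (ha : 0 ≤ a) :
    hybridNorm θ ≤ a ↔
      (∀ k, matSpectralNorm (matPart θ k) ≤ a) ∧ ∀ j, |vecPart θ j| ≤ a := by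
  refine ⟨fun h => ⟨fun k => (matSpectralNorm_le_hybridNorm θ k).trans h, fun j =>
    (abs_le_linftyNorm _ j).trans ((le_max_right _ _).trans h)⟩, fun h => ?_⟩
  exact max_le (Real.iSup_le h.1 ha) (Real.iSup_le h.2 ha)

theorem matPart_add (θ θ' : Params rows cols n) (k : Fin K) :
    matPart (θ + θ') k = matPart θ k + matPart θ' k := rfl

theorem matPart_smul (a : ℝ) (θ : Params rows cols n) (k : Fin K) :
    matPart (a • θ) k = a • matPart θ k := rfl

open scoped Matrix.Norms.L2Operator in
theorem matSpectralNorm_add_le {p q : ℕ} (W W' : Matrix (Fin p) (Fin q) ℝ) :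
    matSpectralNorm (W + W') ≤ matSpectralNorm W + matSpectralNorm W' := by
  simpa only [matSpectralNorm_eq_norm] using norm_add_le W W'

open scoped Matrix.Norms.L2Operator in
theorem matSpectralNorm_smul {p q : ℕ} (a : ℝ) (W : Matrix (Fin p) (Fin q) ℝ) :
    matSpectralNorm (a • W) = |a| * matSpectralNorm W := by
  simpa only [matSpectralNorm_eq_norm, Real.norm_eq_abs] using norm_smul a W

open scoped Matrix.Norms.L2Operator in
theorem isNorm_hybridNorm : IsNorm (hybridNorm (rows := rows) (cols := cols) (n := n)) := by
  have hsmul : ∀ (a : ℝ) (v : Params rows cols n), hybridNorm (a • v) ≤ |a| * hybridNorm v := by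
    intro a v
    refine (hybridNorm_le_iff (mul_nonneg (abs_nonneg a) (hybridNorm_nonneg v))).2
      ⟨fun k => ?_, fun j => ?_⟩
    · rw [matPart_smul, matSpectralNorm_smul]
      gcongr
      exact matSpectralNorm_le_hybridNorm v k
    · have h1 : vecPart (a • v) j = a * vecPart v j := rfl
      rw [h1, abs_mul]
      gcongr
      exact (abs_le_linftyNorm _ j).trans (le_max_right _ _)
  refine ⟨hybridNorm_nonneg, fun v hv => ?_, fun a v => ?_, fun v w => ?_⟩
  · obtain ⟨h1, h2⟩ := (hybridNorm_le_iff le_rfl).1 hv.le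
    ext i
    rcases i with ⟨k, i, j⟩ | j
    · exact abs_nonpos_iff.1 ((abs_entry_le_norm (matPart v k) i j).trans (h1 k))
    · exact abs_nonpos_iff.1 (h2 j)
  · refine le_antisymm (hsmul a v) ?_
    rcases eq_or_ne a 0 with rfl | ha
    · simpa using hybridNorm_nonneg _
    have h1 := hsmul a⁻¹ (a • v)
    rw [smul_smul, inv_mul_cancel₀ ha, one_smul, abs_inv] at h1
    rwa [← le_inv_mul_iff₀ (abs_pos.2 ha)]
  · refine (hybridNorm_le_iff (add_nonneg (hybridNorm_nonneg v) (hybridNorm_nonneg w))).2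
      ⟨fun k => ?_, fun j => ?_⟩
    · rw [matPart_add]
      exact (matSpectralNorm_add_le _ _).trans (add_le_add (matSpectralNorm_le_hybridNorm v k)
        (matSpectralNorm_le_hybridNorm w k))
    · have h1 : vecPart (v + w) j = vecPart v j + vecPart w j := rfl
      rw [h1]
      exact (abs_add_le _ _).trans (add_le_add
        ((abs_le_linftyNorm _ j).trans (le_max_right _ _))
        ((abs_le_linftyNorm _ j).trans (le_max_right _ _)))

theorem inner_params_eq (θ θ' : Params rows cols n) :
    inner ℝ θ θ' = ∑ k, matInner (matPart θ k) (matPart θ' k) +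
      inner ℝ (vecPart θ) (vecPart θ') := by
  simp only [PiLp.inner_apply, Fintype.sum_sum_type, Fintype.sum_sigma, Fintype.sum_prod_type,
    matInner, matPart, vecPart, Matrix.of_apply, RCLike.inner_apply, conj_trivial]
  congr 1
  simp only [mul_comm]

/-- A minimizer on the sphere also minimizes on the ball, since comparison with -v shows the minimum
to be nonpositive. The ball is needed because a hybrid unit vector may have a shorter vector block.
-/
theorem inner_le_of_mem_steepestDirections_linftyNorm {v u w : EuclideanSpace ℝ (Fin n)}
    (hv : v ∈ steepestDirections linftyNorm u) (hw : linftyNorm w ≤ 1) :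
    inner ℝ v u ≤ inner ℝ w u := by
  obtain ⟨hv1, hv⟩ := hv
  have hneg : inner ℝ v u ≤ 0 := by
    have h1 := hv (-v) (by simpa [linftyNorm] using hv1)
    rw [inner_neg_left] at h1
    linarith
  rcases (linftyNorm_nonneg w).eq_or_lt with h0 | h0
  · have hw0 : w = 0 := by
      ext j
      exact abs_nonpos_iff.1 ((abs_le_linftyNorm w j).trans h0.ge)
    rwa [hw0, inner_zero_left]
  · have h1 := hv ((linftyNorm w)⁻¹ • w)
      (by rw [linftyNorm_smul (by positivity), inv_mul_cancel₀ h0.ne'])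
    rw [real_inner_smul_left, le_inv_mul_iff₀ h0] at h1
    nlinarith

/-- Muon directions for the matrices together with a Signum direction for the remaining parameters
form a steepest descent direction for the hybrid norm. -/
theorem mem_steepestDirections_hybridNorm {v μ : Params rows cols n}
    (hmat : ∀ k, matPart v k ∈ muonDirections (matPart μ k))
    (hvec : vecPart v ∈ steepestDirections linftyNorm (vecPart μ)) :
    v ∈ steepestDirections hybridNorm μ := by
  refine ⟨le_antisymm ?_ ?_, fun w hw => ?_⟩
  · exact (hybridNorm_le_iff zero_le_one).2 ⟨fun k => (muonDirections_spec (hmat k)).1,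
      fun j => (abs_le_linftyNorm _ j).trans hvec.1.le⟩
  -- The Signum block has norm exactly 1, so the hybrid norm is 1 even if every Muon block vanishes.
  · exact hvec.1.ge.trans (le_max_right _ _)
  · rw [inner_params_eq, inner_params_eq]
    refine add_le_add (Finset.sum_le_sum fun k _ => (muonDirections_spec (hmat k)).2 _
      ((matSpectralNorm_le_hybridNorm w k).trans hw.le)) ?_
    exact inner_le_of_mem_steepestDirections_linftyNorm hvec ((le_max_right _ _).trans hw.le)

theorem IsMuonSignum.isNormalizedMSD {ℒ : Params rows cols n → ℝ} {c : ℝ} {η : ℝ → ℝ}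
    {θ g : ℝ → Params rows cols n} (h : IsMuonSignum ℒ c η θ g) :
    IsNormalizedMSD hybridNorm ℒ c η θ g :=
  { isNorm := isNorm_hybridNorm
    setup := h.setup
    update := h.update.mono fun _ ⟨v, hv, hmat, hvec⟩ =>
      ⟨v, mem_steepestDirections_hybridNorm hmat hvec, hv⟩ }

end HybridNorm

end MuonSignum

theorem mainTheorem6 {d m K n : ℕ} (hm : 0 < m) (rows cols : Fin K → ℕ)
    (x : Fin m → EuclideanSpace ℝ (Fin d)) (y : Fin m → ℝ) (hy : ∀ i, y i = 1 ∨ y i = -1)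
    (φ : ℝ → ℝ) (hφ : MuonSignum.IsLossExponent φ)
    (f : EuclideanSpace ℝ (Fin d) → MuonSignum.Params rows cols n → ℝ)
    (c : ℝ) (η : ℝ → ℝ) (θ g : ℝ → MuonSignum.Params rows cols n)
    (hθ : MuonSignum.IsMuonSignum (MuonSignum.loss φ f x y) c η θ g) :
    MuonSignum.IsNormalizedMSD MuonSignum.hybridNorm (MuonSignum.loss φ f x y) c η θ g ∧
    ∀ (L : ℝ) (θbar : MuonSignum.Params rows cols n), 1 ≤ L →
      MuonSignum.IsHomogeneous f L →
      MuonSignum.ScheduleCondition η L →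
      MuonSignum.IsNontrivial MuonSignum.hybridNorm θ →
      MuonSignum.ConvergesInDirection MuonSignum.hybridNorm f x y θ θbar →
      ((∀ ξ, ContDiff ℝ 1 (f ξ)) ∨
        ((∀ ξ, LocallyLipschitz (f ξ) ∧ MuonSignum.IsWhitneyC1Stratifiable (f ξ)) ∧
          MuonSignum.SubgradientsConverge MuonSignum.hybridNorm φ f x y L θ g)) →
      ∃ a : ℝ, 0 < a ∧ MuonSignum.IsKKTPoint MuonSignum.hybridNorm f x y (a • θbar) := by
  have : NeZero m := ⟨hm.ne'⟩
  exact ⟨hθ.isNormalizedMSD, fun L θbar hL hhom hη hnt hdir hf =>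
    hθ.isNormalizedMSD.exists_isKKTPoint hφ hL hhom hη hnt hdir hf⟩
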